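/- **Elliptic $(\mathbf B^{(2)}\to\mathbf B^{(1)})$ WP Bailey lemma of type $A_n$.** *Notation.* Expressions such as $u/vw$ mean $u/(vw)$. Let $n\ge 1$, let $p\in\mathbb C$ with $|p|<1$ and $q\in\mathbb C\setminus\{0\}$. For $z\ne 0$ put $\theta(z;p)=\prod_{j\ge 0}(1-zp^j)(1-p^{j+1}/z)$, and for $k\in\mathbb Z$ put $(z;q,p)_k=\prod_{j=0}^{k-1}\theta(zq^j;p)$, where for $k=-m<0$ the product means $\big(\prod_{j=1}^{m}\theta(zq^{-j};p)\big)^{-1}$; write $(z_1,z_2;q,p)_k=(z_1;q,p)_k(z_2;q,p)_k$. For $\boldsymbol k\in\mathbb Z_{\ge 0}^n$ put $|\boldsymbol k|=k_1+\cdots+k_n$. Let $x_1,\dots,x_n\in\mathbb C\setminus\{0\}$, and define matrices indexed by $\boldsymbol k,\boldsymbol j\in\mathbb Z_{\ge0}^n$ by $$B^{(1)}_{\boldsymbol k\boldsymbol j}(a,b)=\frac{(b/a;q,p)_{|\boldsymbol k|-|\boldsymbol j|}}{\prod_{r,s=1}^n(q^{1+j_r-j_s}x_r/x_s;q,p)_{k_r-j_r}}\prod_{r=1}^n\frac{(bx_r;q,p)_{j_r+|\boldsymbol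 k|}}{(ax_rq;q,p)_{k_r+|\boldsymbol j|}},$$ $$B^{(2)}_{\boldsymbol k\boldsymbol j}(a,b)=\frac{(b;q,p)_{|\boldsymbol k|+|\boldsymbol j|}\prod_{r=1}^n(bq^{|\boldsymbol k|-k_r}/ax_r;q,p)_{k_r-j_r}}{\prod_{r,s=1}^n(q^{1+j_r-j_s}x_r/x_s;q,p)_{k_r-j_r}\prod_{r=1}^n(ax_rq;q,p)_{k_r+|\boldsymbol j|}}.$$ Complex sequences $\alpha_{\boldsymbol N}(a,b)$ and $\beta_{\boldsymbol N}(a,b)$ ($\boldsymbol N\in\mathbb Z_{\ge0}^n$) form a *WP Bailey pair with respect to $\mathbf B$ at $(a,b)$* if $\beta_{\boldsymbol N}(a,b)=\sum_{0\le j_r\le N_r,\ r=1,\dots,n}B_{\boldsymbol N\boldsymbol j}(a,b)\,\alpha_{\boldsymbol j}(a,b)$ for all $\boldsymbol N$. *Theorem.* Let $a,b,\rho_1,\rho_2$ be nonzero complex numbers such that no denominator vanishes, that is: $\theta(q^{m+1};p)$, $\theta(ax_rq^{m+1};p)$, $\theta(ax_rq^{m+1}/\rho_1;p)$, $\theta(ax_rq^{m+1}/\rho_2;p)$,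 $\theta(b\rho_1q^m/a;p)$, $\theta(b\rho_2q^m/a;p)$, $\theta(b\rho_1\rho_2q^m/aq;p)$ are nonzero for all integers $m\ge 0$ and all $r$, and $\theta(q^mx_r/x_s;p)\ne0$ for all $r\ne s$ and all $m\in\mathbb Z$. Suppose that $\alpha_{\boldsymbol N}$ and $\beta_{\boldsymbol N}$ form a WP Bailey pair with respect to $\mathbf B^{(2)}$ at $(a,b\rho_1\rho_2/aq)$. Define $$\alpha'_{\boldsymbol N}(a,b)=\frac{(\rho_1,\rho_2;q,p)_{|\boldsymbol N|}}{\prod_{r=1}^n(ax_rq/\rho_1,ax_rq/\rho_2;q,p)_{N_r}}\Big(\frac{aq}{\rho_1\rho_2}\Big)^{|\boldsymbol N|}\prod_{r=1}^nx_r^{N_r}\cdot q^{-\sum_{r<s}N_rN_s}\,\alpha_{\boldsymbol N}(a,b\rho_1\rho_2/aq),$$ $$\begin{aligned}\beta'_{\boldsymbol N}(a,b)={}&\frac{(b\rho_1/a,b\rho_2/a;q,p)_{|\boldsymbol N|}}{\prod_{r=1}^n(ax_rq/\rho_1,ax_rq/\rho_2;q,p)_{N_r}}\sum_{\substack{0\le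 k_r\le N_r\\ r=1,\dots,n}}\Bigg(\frac{(\rho_1,\rho_2;q,p)_{|\boldsymbol k|}}{(b\rho_1/a,b\rho_2/a;q,p)_{|\boldsymbol k|}}\,\frac{\theta(b\rho_1\rho_2q^{2|\boldsymbol k|}/aq;p)}{\theta(b\rho_1\rho_2/aq;p)}\\&\times\frac{\prod_{r=1}^n(bx_r;q,p)_{|\boldsymbol N|+k_r}(ax_rq^{1+k_r-|\boldsymbol k|}/\rho_1\rho_2;q,p)_{N_r-k_r}}{(b\rho_1\rho_2/a;q,p)_{|\boldsymbol N|+|\boldsymbol k|}\prod_{r,s=1}^n(q^{1+k_r-k_s}x_r/x_s;q,p)_{N_r-k_r}}\\&\times\Big(\frac{aq}{\rho_1\rho_2}\Big)^{|\boldsymbol k|}\prod_{r=1}^nx_r^{k_r}\cdot q^{-\sum_{r<s}k_rk_s}\,\beta_{\boldsymbol k}(a,b\rho_1\rho_2/aq)\Bigg).\end{aligned}$$ Then $\alpha'_{\boldsymbol N}(a,b)$ and $\beta'_{\boldsymbol N}(a,b)$ form a WP Bailey pair with respect to $\mathbf B^{(1)}$ at $(a,b)$. -/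

import Mathlib

open Finset

noncomputable section

/-- The infinite shifted factorial `(a; p)_∞ = ∏_{j ≥ 0} (1 - a p^j)`, used for `|p| < 1`. -/
def qFacInf (a p : ℂ) : ℂ := ∏' j : ℕ, (1 - a * p ^ j)

/-- The modified Jacobi theta function `θ(a; p) = (a; p)_∞ (p/a; p)_∞`, used for `a ≠ 0` and
`|p| < 1`. -/
def ellTheta (p a : ℂ) : ℂ := qFacInf a p * qFacInf (p / a) p

/-- The theta shifted factorial `(a; q, p)_k = ∏_{j=0}^{k-1} θ(a q^j; p)` for an integer `k`, with
the usual convention for products: for `m ≥ 1`,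
`(a; q, p)_{-m} = (θ(a q^{-1}; p) θ(a q^{-2}; p) ⋯ θ(a q^{-m}; p))⁻¹`. -/
def ellFac (p q a : ℂ) : ℤ → ℂ
  | Int.ofNat k => ∏ j ∈ range k, ellTheta p (a * q ^ j)
  | Int.negSucc m => (∏ j ∈ range (m + 1), ellTheta p (a * q ^ (-((j : ℤ) + 1))))⁻¹

variable {n : ℕ}

/-- The sum `|k| = k_1 + ⋯ + k_n` of the components, as an integer. -/
def vsum (k : Fin n → ℕ) : ℤ := ∑ r, (k r : ℤ)

/-- The second elementary symmetric function `∑_{r < s} k_r k_s`, as an integer. -/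
def vpairs (k : Fin n → ℕ) : ℤ := ∑ s, ∑ r ∈ Iio s, (k r : ℤ) * (k s : ℤ)

/-- The double product `∏_{r, s = 1}^n (q^{1 + j_r - j_s} x_r / x_s; q, p)_{k_r - j_r}`. -/
def ellDen (p q : ℂ) (x : Fin n → ℂ) (k j : Fin n → ℕ) : ℂ :=
  ∏ r, ∏ s, ellFac p q (q ^ (1 + (j r : ℤ) - (j s : ℤ)) * x r / x s) ((k r : ℤ) - (j r : ℤ))

/-- The elliptic Bressoud matrix `B⁽¹⁾_{k j}(a, b)`. -/
def bressoud1 (p q : ℂ) (x : Fin n → ℂ) (a b : ℂ) (k j : Fin n → ℕ) : ℂ :=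
  ellFac p q (b / a) (vsum k - vsum j) / ellDen p q x k j *
    ∏ r, ellFac p q (b * x r) ((j r : ℤ) + vsum k) / ellFac p q (a * x r * q) ((k r : ℤ) + vsum j)

/-- The elliptic Bressoud matrix `B⁽²⁾_{k j}(a, b)`. -/
def bressoud2 (p q : ℂ) (x : Fin n → ℂ) (a b : ℂ) (k j : Fin n → ℕ) : ℂ :=
  (ellFac p q b (vsum k + vsum j) *
      ∏ r, ellFac p q (b * q ^ (vsum k - (k r : ℤ)) / (a * x r)) ((k r : ℤ) - (j r : ℤ))) /
    (ellDen p q x k j * ∏ r, ellFac p q (a * x r * q) ((k r : ℤ) + vsum j))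

/-- The sequences `α_N(a, b)` and `β_N(a, b)` form a WP Bailey pair with respect to the matrix
`B = (B_{k j}(a, b))`, at the parameters `a, b`:
`β_N(a, b) = ∑_{0 ≤ j_r ≤ N_r} B_{N j}(a, b) α_j(a, b)` for every `N`. -/
def IsWPBaileyPair (B : ℂ → ℂ → (Fin n → ℕ) → (Fin n → ℕ) → ℂ)
    (α β : ℂ → ℂ → (Fin n → ℕ) → ℂ) (a b : ℂ) : Prop :=
  ∀ N : Fin n → ℕ, β a b N = ∑ j ∈ Icc 0 N, B a b N j * α a b j

/-- The sequence `α'_N(a, b)` built from `α` with the extra parameters `ρ₁, ρ₂`. -/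
def alphaPrime (p q : ℂ) (x : Fin n → ℂ) (ρ₁ ρ₂ : ℂ) (α : ℂ → ℂ → (Fin n → ℕ) → ℂ)
    (a b : ℂ) (N : Fin n → ℕ) : ℂ :=
  ellFac p q ρ₁ (vsum N) * ellFac p q ρ₂ (vsum N) /
      (∏ r, ellFac p q (a * x r * q / ρ₁) (N r) * ellFac p q (a * x r * q / ρ₂) (N r)) *
    (a * q / (ρ₁ * ρ₂)) ^ vsum N * (∏ r, x r ^ N r) * q ^ (-vpairs N) *
    α a (b * ρ₁ * ρ₂ / (a * q)) N

/-- The sequence `β'_N(a, b)` built from `β` with the extra parameters `ρ₁, ρ₂`. -/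
def betaPrime (p q : ℂ) (x : Fin n → ℂ) (ρ₁ ρ₂ : ℂ) (β : ℂ → ℂ → (Fin n → ℕ) → ℂ)
    (a b : ℂ) (N : Fin n → ℕ) : ℂ :=
  ellFac p q (b * ρ₁ / a) (vsum N) * ellFac p q (b * ρ₂ / a) (vsum N) /
      (∏ r, ellFac p q (a * x r * q / ρ₁) (N r) * ellFac p q (a * x r * q / ρ₂) (N r)) *
    ∑ k ∈ Icc 0 N,
      ellFac p q ρ₁ (vsum k) * ellFac p q ρ₂ (vsum k) /
          (ellFac p q (b * ρ₁ / a) (vsum k) * ellFac p q (b * ρ₂ / a) (vsum k)) *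
        (ellTheta p (b * ρ₁ * ρ₂ * q ^ (2 * vsum k) / (a * q)) /
          ellTheta p (b * ρ₁ * ρ₂ / (a * q))) *
        ((∏ r, ellFac p q (b * x r) (vsum N + (k r : ℤ)) *
              ellFac p q (a * x r * q ^ (1 + (k r : ℤ) - vsum k) / (ρ₁ * ρ₂))
                ((N r : ℤ) - (k r : ℤ))) /
          (ellFac p q (b * ρ₁ * ρ₂ / a) (vsum N + vsum k) * ellDen p q x N k)) *
        (a * q / (ρ₁ * ρ₂)) ^ vsum k * (∏ r, x r ^ k r) * q ^ (-vpairs k) *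
        β a (b * ρ₁ * ρ₂ / (a * q)) k

end

/-! Write c = bρ₁ρ₂/(aq). Inserting the definition of β_k into β'_N and interchanging the two finite
sums reduces the theorem to one identity for each pair j ≤ N: the sum over j ≤ k ≤ N of the
coefficient of β_k times B⁽²⁾_{kj}(a, c) must equal an explicit product. This is an elliptic Jackson
summation of type A_n (`sum_jacksonTerm`).

The Jackson sum is a specialization of an identity about arbitrary points
(`sum_subsetCoeff_mul_subsetWeight`). For a finite set X of points, one sums over all subsets S a
coefficient depending on |S| only, times a product of theta functions over S and over X \ S, times
the interaction ∏ θ(q x_j/x_i)/θ(x_j/x_i) with i in S and j outside; the result factorizes. When the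
points are the strings x_r q^i with j_r ≤ i < N_r, the interaction contains θ(1) = 0 unless S meets
each string in an initial segment. The surviving subsets are indexed by the vectors k, and on them
the interaction telescopes to the denominators of the Bressoud matrices.

The subset identity goes by induction on X. A new point o either stays outside S or joins it. In
both cases the weight is expanded by an elliptic partial fraction formula into a multiple of the old
weight of (S, X \ S) plus residue terms in which o trades places with some old point. The residues
of the two cases carry opposite signs and cancel in pairs, and the remaining coefficients satisfy a
recurrence that is a single Weierstrass three-term relation.

The theta function enters only through reflection and Weierstrass' relation (`IsThetaFun`).
Weierstrass' relation is obtained from the Jacobi triple product: θ(xy)θ(x/y) is, up to factors, a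
2×2 determinant in x and y, and the three-term relation is then the Plücker relation. -/

/-! ### Gaussian binomials and the finite q-binomial theorem -/

/-- The Gaussian binomial coefficient, defined by its Pascal recursion. -/
def gaussBinom (p : ℂ) : ℕ → ℕ → ℂ
  | _, 0 => 1
  | 0, _ + 1 => 0
  | N + 1, k + 1 => p ^ (k + 1) * gaussBinom p N (k + 1) + gaussBinom p N k

/-- The finite shifted factorial `(p; p)_m`. -/
def qFac (p : ℂ) (m : ℕ) : ℂ := ∏ i ∈ range m, (1 - p ^ (i + 1))

theorem gaussBinom_zero_right (p : ℂ) (N : ℕ) : gaussBinom p N 0 = 1 := by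
  cases N <;> rfl

theorem gaussBinom_eq_zero (p : ℂ) : ∀ N k : ℕ, N < k → gaussBinom p N k = 0
  | _, 0, h => absurd h (by omega)
  | 0, _ + 1, _ => rfl
  | N + 1, k + 1, h => by
    rw [gaussBinom, gaussBinom_eq_zero p N (k + 1) (by omega),
      gaussBinom_eq_zero p N k (by omega)]
    ring

theorem gaussBinom_mul_qFac (p : ℂ) : ∀ k m : ℕ,
    gaussBinom p (k + m) k * (qFac p k * qFac p m) = qFac p (k + m)
  | 0, m => by simp [gaussBinom_zero_right, qFac]
  | k + 1, 0 => by
    have h := gaussBinom_mul_qFac p k 0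
    simp only [add_zero] at h ⊢
    rw [gaussBinom, gaussBinom_eq_zero p k (k + 1) (by omega)]
    simp only [qFac, prod_range_succ, prod_range_zero] at h ⊢
    linear_combination (1 - p ^ (k + 1)) * h
  | k + 1, m + 1 => by
    have h₁ := gaussBinom_mul_qFac p (k + 1) m
    have h₂ := gaussBinom_mul_qFac p k (m + 1)
    have e₁ : k + 1 + m = k + m + 1 := by ring
    have e₂ : k + 1 + (m + 1) = k + m + 1 + 1 := by ring
    have e₃ : k + (m + 1) = k + m + 1 := by ring
    rw [e₁] at h₁
    rw [e₃] at h₂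
    rw [e₂, gaussBinom]
    have e₄ : qFac p (k + m + 1 + 1) = qFac p (k + m + 1) * (1 - p ^ (k + m + 1 + 1)) := by
      rw [qFac, prod_range_succ]; rfl
    have e₅ (m : ℕ) : qFac p (m + 1) = qFac p m * (1 - p ^ (m + 1)) := by
      rw [qFac, prod_range_succ]; rfl
    rw [e₄]
    have e₆ := e₅ m
    have e₇ := e₅ k
    have h₁' : p ^ (k + 1) * gaussBinom p (k + m + 1) (k + 1) * (qFac p (k + 1) * qFac p (m + 1))
        = p ^ (k + 1) * (1 - p ^ (m + 1)) * qFac p (k + m + 1) := by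
      rw [← h₁, e₆]; ring
    have h₂' : gaussBinom p (k + m + 1) k * (qFac p (k + 1) * qFac p (m + 1))
        = (1 - p ^ (k + 1)) * qFac p (k + m + 1) := by
      rw [← h₂, e₇]; ring
    rw [add_mul, h₁', h₂']
    ring

/-- Rothe's finite `q`-binomial theorem. -/
theorem prod_one_add_mul_pow (r : ℂ) : ∀ (N : ℕ) (w : ℂ),
    ∏ j ∈ range N, (1 + w * (r ^ 2) ^ j) =
      ∑ k ∈ range (N + 1), gaussBinom (r ^ 2) N k * r ^ (k * (k - 1)) * w ^ k
  | 0, w => by simp [gaussBinom]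
  | N + 1, w => by
    rw [prod_range_succ']
    have h := prod_one_add_mul_pow r N (w * r ^ 2)
    have e : ∏ j ∈ range N, (1 + w * (r ^ 2) ^ (j + 1)) =
        ∏ j ∈ range N, (1 + w * r ^ 2 * (r ^ 2) ^ j) :=
      prod_congr rfl fun j _ => by ring
    rw [e, h, sum_range_succ' _ (N + 1)]
    have hlast : ∑ k ∈ range (N + 1), gaussBinom (r ^ 2) N k * r ^ (k * (k - 1)) * (w * r ^ 2) ^ k
        = ∑ k ∈ range (N + 1), gaussBinom (r ^ 2) N (k + 1) * r ^ ((k + 1) * k)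
          * (w * r ^ 2) ^ (k + 1) + 1 := by
      rw [sum_range_succ', sum_range_succ _ N, gaussBinom_eq_zero _ N (N + 1) (by omega)]
      simp [gaussBinom_zero_right]
    have e2 : ∑ k ∈ range (N + 1), gaussBinom (r ^ 2) (N + 1) (k + 1) * r ^ ((k + 1) * (k + 1 - 1))
          * w ^ (k + 1) =
        ∑ k ∈ range (N + 1), gaussBinom (r ^ 2) N (k + 1) * r ^ ((k + 1) * k)
          * (w * r ^ 2) ^ (k + 1) + w * ∑ k ∈ range (N + 1),
            gaussBinom (r ^ 2) N k * r ^ (k * (k - 1)) * (w * r ^ 2) ^ k := by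
      rw [mul_sum, ← sum_add_distrib]
      refine sum_congr rfl fun k _ => ?_
      rw [gaussBinom, Nat.add_sub_cancel]
      have : r ^ ((k + 1) * k) = r ^ (k * (k - 1)) * (r ^ 2) ^ k := by
        rw [← pow_mul, ← pow_add]
        congr 1
        cases k with
        | zero => rfl
        | succ k => simp only [Nat.add_sub_cancel]; ring
      rw [this]
      ring
    rw [e2, mul_add, mul_one, pow_zero, mul_one]
    nth_rewrite 1 [hlast]
    simp [gaussBinom_zero_right]
    ring

/-! ### Convergence of the infinite products, reflection for theta -/

theorem summable_norm_mul_pow {p : ℂ} (hp : ‖p‖ < 1) (a : ℂ) :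
    Summable fun j : ℕ => ‖-(a * p ^ j)‖ := by
  simpa using (summable_geometric_of_lt_one (norm_nonneg p) hp).mul_left ‖a‖

theorem multipliable_qFacInf {p : ℂ} (hp : ‖p‖ < 1) (a : ℂ) :
    Multipliable fun j : ℕ => 1 - a * p ^ j := by
  simpa [sub_eq_add_neg] using multipliable_one_add_of_summable (summable_norm_mul_pow hp a)

theorem tendsto_prod_qFacInf {p : ℂ} (hp : ‖p‖ < 1) (a : ℂ) :
    Filter.Tendsto (fun N => ∏ j ∈ range N, (1 - a * p ^ j)) Filter.atTop (nhds (qFacInf a p)) :=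
  (multipliable_qFacInf hp a).hasProd.tendsto_prod_nat

theorem qFacInf_eq {p : ℂ} (hp : ‖p‖ < 1) (a : ℂ) :
    qFacInf a p = (1 - a) * qFacInf (a * p) p := by
  have h := (multipliable_qFacInf hp (a * p))
  rw [qFacInf, tprod_eq_zero_mul']
  · simp [qFacInf, pow_succ', mul_assoc]
  · simpa [pow_succ', mul_assoc] using h

theorem ellTheta_inv {p : ℂ} (hp : ‖p‖ < 1) {z : ℂ} (hz : z ≠ 0) :
    ellTheta p z⁻¹ = -z⁻¹ * ellTheta p z := by
  rw [ellTheta, ellTheta, qFacInf_eq hp z⁻¹, qFacInf_eq hp z]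
  rw [show p / z⁻¹ = z * p by field_simp, show p / z = z⁻¹ * p by field_simp]
  field_simp
  ring

theorem one_sub_pow_ne_zero {p : ℂ} (hp : ‖p‖ < 1) (i : ℕ) : 1 - p ^ (i + 1) ≠ 0 := by
  intro h
  have h1 : ‖p ^ (i + 1)‖ = 1 := by rw [← sub_eq_zero.mp h]; simp
  rw [norm_pow] at h1
  exact absurd h1 (pow_lt_one₀ (norm_nonneg _) hp (by omega)).ne

theorem qFac_ne_zero {p : ℂ} (hp : ‖p‖ < 1) (m : ℕ) : qFac p m ≠ 0 :=
  prod_ne_zero_iff.mpr fun i _ => one_sub_pow_ne_zero hp i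

theorem tendsto_qFac {p : ℂ} (hp : ‖p‖ < 1) :
    Filter.Tendsto (qFac p) Filter.atTop (nhds (qFacInf p p)) := by
  convert tendsto_prod_qFacInf hp p using 2 with N
  exact prod_congr rfl fun i _ => by rw [pow_succ']

theorem qFacInf_self_ne_zero {p : ℂ} (hp : ‖p‖ < 1) : qFacInf p p ≠ 0 := by
  have h := tprod_one_add_ne_zero_of_summable (f := fun j : ℕ => -(p * p ^ j)) (fun i => by
    simpa [pow_succ', sub_eq_add_neg] using one_sub_pow_ne_zero hp i) (summable_norm_mul_pow hp p)
  simpa [qFacInf, sub_eq_add_neg] using h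

/-- Since (p; p)_m tends to a nonzero limit, both it and its inverse are bounded in m. The uniform
bound supplies the dominating series in the limit of the finite triple product. -/
theorem exists_gaussBinom_bound {p : ℂ} (hp : ‖p‖ < 1) :
    ∃ C : ℝ, ∀ k m : ℕ, ‖gaussBinom p (k + m) k‖ ≤ C := by
  obtain ⟨A, hA⟩ := (tendsto_qFac hp).norm.bddAbove_range
  obtain ⟨B, hB⟩ := ((tendsto_qFac hp).inv₀ (qFacInf_self_ne_zero hp)).norm.bddAbove_range
  refine ⟨A * (B * B), fun k m => ?_⟩
  have h := gaussBinom_mul_qFac p k m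
  have h1 := qFac_ne_zero hp k
  have h2 := qFac_ne_zero hp m
  have e : gaussBinom p (k + m) k = qFac p (k + m) * ((qFac p k)⁻¹ * (qFac p m)⁻¹) := by
    field_simp
    linear_combination h
  rw [e, norm_mul, norm_mul]
  have a1 := hA ⟨k + m, rfl⟩
  have b1 := hB ⟨k, rfl⟩
  have b2 := hB ⟨m, rfl⟩
  simp only at a1 b1 b2
  have hA0 := (norm_nonneg _).trans a1
  have hB0 := (norm_nonneg _).trans b1
  gcongr

/-! ### The theta series and the Jacobi triple product -/

open Filter Topology in
theorem summable_sq_pow_nat {r : ℂ} (hr0 : r ≠ 0) (hr : ‖r‖ < 1) {z : ℂ} (hz : z ≠ 0) :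
    Summable fun m : ℕ => r ^ (m ^ 2) * z ^ m := by
  refine summable_of_ratio_test_tendsto_lt_one (l := 0) one_pos
    (Eventually.of_forall fun m => mul_ne_zero (pow_ne_zero _ hr0) (pow_ne_zero _ hz)) ?_
  have h : Tendsto (fun m : ℕ => ‖r * z‖ * (‖r‖ ^ 2) ^ m) atTop (𝓝 (‖r * z‖ * 0)) :=
    (tendsto_pow_atTop_nhds_zero_of_lt_one (by positivity)
      (pow_lt_one₀ (norm_nonneg _) hr two_ne_zero)).const_mul _
  rw [mul_zero] at h
  refine h.congr fun m => ?_
  rw [eq_div_iff (norm_ne_zero_iff.mpr (mul_ne_zero (pow_ne_zero _ hr0) (pow_ne_zero _ hz))), ← norm_pow,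
    ← norm_pow, ← norm_mul, ← norm_mul]
  congr 1
  ring

theorem summable_sq_zpow {r : ℂ} (hr0 : r ≠ 0) (hr : ‖r‖ < 1) {z : ℂ} (hz : z ≠ 0) :
    Summable fun m : ℤ => r ^ (m ^ 2) * z ^ m := by
  refine Summable.of_nat_of_neg ?_ ?_
  · simpa using mod_cast summable_sq_pow_nat hr0 hr hz
  · have h := summable_sq_pow_nat hr0 hr (inv_ne_zero hz)
    refine h.congr fun m => ?_
    rw [neg_sq, zpow_neg, zpow_natCast, inv_pow]
    congr 1

/-- The terms of the Laurent expansion of the modified theta function of nome `r ^ 2`. -/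
noncomputable def thetaTerm (r z : ℂ) (m : ℤ) : ℂ := (-1) ^ m * r ^ (m ^ 2 - m) * z ^ m

theorem summable_thetaTerm {r : ℂ} (hr0 : r ≠ 0) (hr : ‖r‖ < 1) {z : ℂ} (hz : z ≠ 0) :
    Summable (thetaTerm r z) := by
  refine (summable_sq_zpow hr0 hr (z := -(z / r)) (neg_ne_zero.mpr (div_ne_zero hz hr0))).congr
    fun m => ?_
  rw [thetaTerm, neg_eq_neg_one_mul (z / r), mul_zpow, div_zpow, zpow_sub₀ hr0]
  ring

theorem neg_one_zpow_mul_self (m : ℤ) : (-1 : ℂ) ^ m * (-1) ^ m = 1 := by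
  rw [← mul_zpow]; simp

/-- The finite form of the Jacobi triple product identity. -/
theorem prod_eq_sum_thetaTerm {r : ℂ} (hr0 : r ≠ 0) {z : ℂ} (hz : z ≠ 0) (N : ℕ) :
    (∏ j ∈ range N, (1 - z * (r ^ 2) ^ j)) * ∏ j ∈ range N, (1 - r ^ 2 / z * (r ^ 2) ^ j) =
      ∑ k ∈ range (2 * N + 1), gaussBinom (r ^ 2) (2 * N) k * thetaTerm r z ((k : ℤ) - N) := by
  -- Taking 2N factors and w = -z p^{-N}, with p = r², centres the product: the first N factors,
  -- reversed, are monomials times 1 - p^{j+1}/z, and the last N are 1 - z p^j.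
  have h := prod_one_add_mul_pow r (2 * N) (-(z * ((r ^ 2) ^ N)⁻¹))
  have hneg : ∏ j ∈ range N, (1 + -(z * ((r ^ 2) ^ N)⁻¹) * (r ^ 2) ^ j) =
      (-z) ^ N * (r ^ (N * (N + 1)))⁻¹ * ∏ j ∈ range N, (1 - r ^ 2 / z * (r ^ 2) ^ j) := by
    rw [← prod_range_reflect]
    have e : ∀ j ∈ range N, 1 + -(z * ((r ^ 2) ^ N)⁻¹) * (r ^ 2) ^ (N - 1 - j) =
        -z * (r ^ (2 * (j + 1)))⁻¹ * (1 - r ^ 2 / z * (r ^ 2) ^ j) := by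
      intro j hj
      have hj := mem_range.mp hj
      have : (r ^ 2) ^ N = (r ^ 2) ^ (N - 1 - j) * (r ^ 2) ^ (j + 1) := by
        rw [← pow_add]; congr 1; omega
      rw [this]
      field_simp
      ring
    rw [prod_congr rfl e, prod_mul_distrib, prod_mul_distrib, prod_const, card_range, prod_inv_distrib]
    congr 3
    rw [prod_pow_eq_pow_sum, ← mul_sum, sum_add_distrib, mul_add, mul_comm 2, sum_range_id_mul_two]
    congr 1
    cases N with
    | zero => rfl
    | succ N => simp; ring
  have hpos : ∏ j ∈ range N, (1 + -(z * ((r ^ 2) ^ N)⁻¹) * (r ^ 2) ^ (N + j)) =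
      ∏ j ∈ range N, (1 - z * (r ^ 2) ^ j) := by
    refine prod_congr rfl fun j _ => ?_
    rw [pow_add]
    field_simp
    ring
  rw [two_mul, prod_range_add, hneg, hpos] at h
  have h2 : (∏ j ∈ range N, (1 - z * (r ^ 2) ^ j)) * ∏ j ∈ range N, (1 - r ^ 2 / z * (r ^ 2) ^ j) =
      ((-z) ^ N * (r ^ (N * (N + 1)))⁻¹)⁻¹ * ((-z) ^ N * (r ^ (N * (N + 1)))⁻¹ *
        (∏ j ∈ range N, (1 - r ^ 2 / z * (r ^ 2) ^ j)) * ∏ j ∈ range N, (1 - z * (r ^ 2) ^ j)) := by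
    have : (-z) ^ N ≠ 0 := pow_ne_zero _ (neg_ne_zero.mpr hz)
    field_simp
  rw [h2, h, mul_sum, two_mul]
  refine sum_congr rfl fun k _ => ?_
  have e1 : thetaTerm r z ((k : ℤ) - N) = ((-z) ^ N * (r ^ (N * (N + 1)))⁻¹)⁻¹ *
      (r ^ (k * (k - 1)) * (-(z * ((r ^ 2) ^ N)⁻¹)) ^ k) := by
    have hk : r ^ (k * (k - 1)) = r ^ ((k : ℤ) ^ 2 - k) := by
      rw [← zpow_natCast]
      congr 1
      cases k with
      | zero => rfl
      | succ k => simp; ring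
    have h3 : ((k : ℤ) - N) ^ 2 - (k - N) = ((k : ℤ) ^ 2 - k) + ((N * (N + 1) : ℕ) : ℤ)
        - ((2 * N * k : ℕ) : ℤ) := by push_cast; ring
    rw [thetaTerm, hk, h3, zpow_sub₀ hr0, zpow_add₀ hr0, zpow_natCast, zpow_natCast,
      zpow_sub₀ hz, zpow_sub₀ (by norm_num : (-1 : ℂ) ≠ 0), zpow_natCast, zpow_natCast,
      zpow_natCast, zpow_natCast, neg_pow z, neg_pow (z * _), mul_pow, inv_pow, ← pow_mul,
      ← pow_mul]
    field_simp
    rw [mul_assoc]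
  rw [e1]
  ring

open Filter Topology in
/-- The Jacobi triple product identity, up to a constant independent of `z`. -/
theorem ellTheta_eq_tsum {r : ℂ} (hr0 : r ≠ 0) (hr : ‖r ^ 2‖ < 1) {z : ℂ} (hz : z ≠ 0) :
    ellTheta (r ^ 2) z = (qFacInf (r ^ 2) (r ^ 2))⁻¹ * ∑' m : ℤ, thetaTerm r z m := by
  have hr1 : ‖r‖ < 1 := by
    rw [norm_pow] at hr
    exact lt_of_pow_lt_pow_left₀ 2 zero_le_one (by simpa using hr)
  obtain ⟨C, hC⟩ := exists_gaussBinom_bound hr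
  -- The finite sums are extended by zero to all of ℤ, so that dominated convergence for series
  -- applies.
  let f : ℕ → ℤ → ℂ := fun N m =>
    if m ∈ Icc (-(N : ℤ)) N then gaussBinom (r ^ 2) (2 * N) (m + N).toNat * thetaTerm r z m else 0
  have hf : ∀ N : ℕ, (∏ j ∈ range N, (1 - z * (r ^ 2) ^ j)) *
      ∏ j ∈ range N, (1 - r ^ 2 / z * (r ^ 2) ^ j) = ∑' m, f N m := by
    intro N
    rw [prod_eq_sum_thetaTerm hr0 hz, tsum_eq_sum (s := Icc (-(N : ℤ)) N)
      fun m hm => if_neg hm]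
    refine sum_bij (fun k _ => (k : ℤ) - N) ?_ ?_ ?_ ?_
    · intro k hk
      have := mem_range.mp hk
      rw [mem_Icc]; omega
    · intro k _ l _ h
      omega
    · intro m hm
      have := mem_Icc.mp hm
      exact ⟨(m + N).toNat, mem_range.mpr (by omega), by omega⟩
    · intro k hk
      have := mem_range.mp hk
      rw [if_pos (mem_Icc.mpr (by omega))]
      simp
  have hlim : Tendsto (fun N => ∑' m, f N m) atTop (𝓝 (ellTheta (r ^ 2) z)) := by
    refine Tendsto.congr hf ?_
    exact (tendsto_prod_qFacInf hr z).mul (tendsto_prod_qFacInf hr (r ^ 2 / z))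
  -- For fixed m the Gaussian binomial tends to (p; p)_∞ / (p; p)_∞² = 1 / (p; p)_∞, which is the
  -- constant in the statement.
  have hlim2 : Tendsto (fun N => ∑' m, f N m) atTop
      (𝓝 (∑' m, (qFacInf (r ^ 2) (r ^ 2))⁻¹ * thetaTerm r z m)) := by
    refine tendsto_tsum_of_dominated_convergence
      ((summable_thetaTerm hr0 hr1 hz).norm.mul_left C) (fun m => ?_)
      (Eventually.of_forall fun N m => ?_)
    · have hL := qFacInf_self_ne_zero hr
      have hQ := tendsto_qFac hr
      have a1 : Tendsto (fun N : ℕ => (m + N).toNat) atTop atTop := by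
        refine tendsto_atTop.mpr fun b => ?_
        filter_upwards [eventually_ge_atTop (b + m.natAbs)] with N hN
        omega
      have a2 : Tendsto (fun N : ℕ => ((N : ℤ) - m).toNat) atTop atTop := by
        refine tendsto_atTop.mpr fun b => ?_
        filter_upwards [eventually_ge_atTop (b + m.natAbs)] with N hN
        omega
      have a3 : Tendsto (fun N : ℕ => 2 * N) atTop atTop :=
        tendsto_atTop.mpr fun b => by
          filter_upwards [eventually_ge_atTop b] with N hN
          omega
      have hT := ((hQ.comp a3).mul (((hQ.comp a1).mul (hQ.comp a2)).inv₀
        (mul_ne_zero hL hL))).mul_const (thetaTerm r z m)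
      have e : qFacInf (r ^ 2) (r ^ 2) * (qFacInf (r ^ 2) (r ^ 2) * qFacInf (r ^ 2) (r ^ 2))⁻¹ =
          (qFacInf (r ^ 2) (r ^ 2))⁻¹ := by field_simp
      rw [e] at hT
      refine hT.congr' ?_
      filter_upwards [eventually_ge_atTop m.natAbs] with N hN
      simp only [f, Function.comp]
      rw [if_pos (mem_Icc.mpr (by omega))]
      have h := gaussBinom_mul_qFac (r ^ 2) (m + N).toNat ((N : ℤ) - m).toNat
      rw [show (m + N).toNat + ((N : ℤ) - m).toNat = 2 * N by omega] at h
      rw [← h]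
      have n1 := qFac_ne_zero hr (m + N).toNat
      have n2 := qFac_ne_zero hr ((N : ℤ) - m).toNat
      field_simp
    · simp only [f]
      split_ifs with hm
      · rw [norm_mul]
        have := mem_Icc.mp hm
        have h := hC (m + N).toNat ((N : ℤ) - m).toNat
        rw [show (m + N).toNat + ((N : ℤ) - m).toNat = 2 * N by omega] at h
        gcongr
      · rw [norm_zero]
        have : 0 ≤ C := (norm_nonneg _).trans (hC 0 0)
        positivity
  rw [tendsto_nhds_unique hlim hlim2, tsum_mul_left]

/-! ### Weierstrass' three-term relation -/

/-- Pairs of integers, split by whether they have equal or opposite parity. -/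
def intPairParity : (ℤ × ℤ) ⊕ (ℤ × ℤ) → ℤ × ℤ
  | .inl (s, t) => (s + t, s - t)
  | .inr (s, t) => (s + t + 1, s - t)

theorem intPairParity_bijective : Function.Bijective intPairParity := by
  constructor
  · rintro (⟨s, t⟩ | ⟨s, t⟩) (⟨s', t'⟩ | ⟨s', t'⟩) h <;>
      simp only [intPairParity, Prod.mk.injEq] at h
    · have h1 : s = s' := by omega
      have h2 : t = t' := by omega
      rw [h1, h2]
    · omega
    · omega
    · have h1 : s = s' := by omega
      have h2 : t = t' := by omega
      rw [h1, h2]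
  · rintro ⟨k, l⟩
    rcases Int.even_or_odd (k - l) with ⟨t, ht⟩ | ⟨t, ht⟩
    · exact ⟨.inl (l + t, t), by simp only [intPairParity, Prod.mk.injEq]; omega⟩
    · exact ⟨.inr (l + t, t), by simp only [intPairParity, Prod.mk.injEq]; omega⟩

/-- The double series over (k, l) splits by the parity of k - l. Putting (k, l) = (s + t, s - t) or
(s + t + 1, s - t) diagonalizes the quadratic exponent, so each half is a function of x times a
function of y. The two halves have opposite signs and involve the same pair C₀, C₁ with roles
exchanged, hence the determinant. -/
theorem exists_tsum_thetaTerm_mul {r : ℂ} (hr0 : r ≠ 0) (hr : ‖r‖ < 1) :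
    ∃ C₀ C₁ : ℂ → ℂ, ∀ x y : ℂ, x ≠ 0 → y ≠ 0 →
      (∑' m, thetaTerm r (x * y) m) * ∑' m, thetaTerm r (x / y) m =
        x * (C₁ x * C₀ y - C₀ x * C₁ y) := by
  have hr2 : ‖r ^ 2‖ < 1 := by
    rw [norm_pow]; exact pow_lt_one₀ (norm_nonneg _) hr two_ne_zero
  have hr20 : r ^ 2 ≠ 0 := pow_ne_zero _ hr0
  refine ⟨fun x => ∑' s : ℤ, r ^ (2 * s ^ 2) * x ^ (2 * s),
    fun x => ∑' s : ℤ, r ^ (2 * s ^ 2 + 2 * s) * x ^ (2 * s + 1), fun x y hx hy => ?_⟩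
  have s0 : ∀ x : ℂ, x ≠ 0 → Summable fun s : ℤ => r ^ (2 * s ^ 2) * x ^ (2 * s) := fun x hx => by
    refine (summable_sq_zpow hr20 hr2 (pow_ne_zero 2 hx)).congr fun s => ?_
    rw [zpow_mul r, zpow_mul x]; rfl
  have s1 : ∀ x : ℂ, x ≠ 0 → Summable fun s : ℤ => r ^ (2 * s ^ 2 + 2 * s) * x ^ (2 * s + 1) :=
    fun x hx => by
    refine ((summable_sq_zpow hr20 hr2 (mul_ne_zero hr20 (pow_ne_zero 2 hx))).mul_left x).congr
      fun s => ?_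
    rw [zpow_add₀ hx, zpow_add₀ hr0, zpow_mul r, zpow_mul x, zpow_mul r, mul_zpow, zpow_one]
    simp only [zpow_ofNat]
    ring
  have s1' : x * ∑' s : ℤ, r ^ (2 * s ^ 2 + 2 * s) * x ^ (2 * s + 1) =
      ∑' s : ℤ, r ^ (2 * s ^ 2 - 2 * s) * x ^ (2 * s) := by
    rw [← tsum_mul_left, ← (Equiv.addRight (1 : ℤ)).tsum_eq
      (fun s : ℤ => r ^ (2 * s ^ 2 - 2 * s) * x ^ (2 * s))]
    refine tsum_congr fun s => ?_
    simp only [Equiv.coe_addRight]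
    rw [show 2 * (s + 1) ^ 2 - 2 * (s + 1) = 2 * s ^ 2 + 2 * s by ring,
      show 2 * (s + 1) = 1 + (2 * s + 1) by ring, zpow_add₀ hx 1, zpow_one]
    ring
  have s1s : Summable fun s : ℤ => r ^ (2 * s ^ 2 - 2 * s) * x ^ (2 * s) := by
    have h := (s1 x hx).mul_left x
    rw [← (Equiv.addRight (1 : ℤ)).summable_iff]
    refine h.congr fun s => ?_
    simp only [Equiv.coe_addRight, Function.comp]
    rw [show 2 * (s + 1) ^ 2 - 2 * (s + 1) = 2 * s ^ 2 + 2 * s by ring,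
      show 2 * (s + 1) = 1 + (2 * s + 1) by ring, zpow_add₀ hx 1, zpow_one]
    ring
  have hxy := mul_ne_zero hx hy
  have hxy' := div_ne_zero hx hy
  have sx := summable_thetaTerm hr0 hr hxy
  have sy := summable_thetaTerm hr0 hr hxy'
  rw [tsum_mul_tsum_of_summable_norm sx.norm sy.norm,
    ← (Equiv.ofBijective _ intPairParity_bijective).tsum_eq]
  simp only [Equiv.ofBijective_apply]
  have hz (a b : ℤ) : (x * y) ^ a * (x / y) ^ b = x ^ (a + b) * y ^ (a - b) := by
    rw [mul_zpow, div_zpow, zpow_add₀ hx, zpow_sub₀ hy]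
    ring
  have i1 : ∀ z : ℤ × ℤ, thetaTerm r (x * y) (intPairParity (.inl z)).1 *
      thetaTerm r (x / y) (intPairParity (.inl z)).2 =
      (r ^ (2 * z.1 ^ 2 - 2 * z.1) * x ^ (2 * z.1)) * (r ^ (2 * z.2 ^ 2) * y ^ (2 * z.2)) := by
    rintro ⟨s, t⟩
    simp only [intPairParity, thetaTerm]
    have e1 : (s + t) ^ 2 - (s + t) = (2 * s ^ 2 - 2 * s) + 2 * t ^ 2 - ((s - t) ^ 2 - (s - t)) := by
      ring
    have e2 : (-1 : ℂ) ^ (s + t) = (-1) ^ (s - t) := by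
      rw [show s + t = (s - t) + (t + t) by ring, zpow_add₀ (by norm_num),
        zpow_add₀ (by norm_num) t, neg_one_zpow_mul_self, mul_one]
    have e3 : (x * y) ^ (s + t) * (x / y) ^ (s - t) = x ^ (2 * s) * y ^ (2 * t) := by
      rw [hz, show (s + t) + (s - t) = 2 * s by ring, show (s + t) - (s - t) = 2 * t by ring]
    rw [e2, e1, zpow_sub₀ hr0 (2 * s ^ 2 - 2 * s + 2 * t ^ 2), zpow_add₀ hr0]
    have n1 := zpow_ne_zero ((s - t) ^ 2 - (s - t)) hr0
    calc _ = ((-1 : ℂ) ^ (s - t) * (-1) ^ (s - t)) * (r ^ (2 * s ^ 2 - 2 * s) * r ^ (2 * t ^ 2)) *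
          ((x * y) ^ (s + t) * (x / y) ^ (s - t)) := by field_simp
      _ = _ := by rw [neg_one_zpow_mul_self, e3]; ring
  have i2 : ∀ z : ℤ × ℤ, thetaTerm r (x * y) (intPairParity (.inr z)).1 *
      thetaTerm r (x / y) (intPairParity (.inr z)).2 =
      -x * ((r ^ (2 * z.1 ^ 2) * x ^ (2 * z.1)) *
        (r ^ (2 * z.2 ^ 2 + 2 * z.2) * y ^ (2 * z.2 + 1))) := by
    rintro ⟨s, t⟩
    simp only [intPairParity, thetaTerm]
    have e1 : (s + t + 1) ^ 2 - (s + t + 1) =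
        2 * s ^ 2 + (2 * t ^ 2 + 2 * t) - ((s - t) ^ 2 - (s - t)) := by
      ring
    have e2 : (-1 : ℂ) ^ (s + t + 1) = -(-1) ^ (s - t) := by
      rw [show s + t + 1 = (s - t) + (t + t) + 1 by ring, zpow_add₀ (by norm_num),
        zpow_add₀ (by norm_num) (s - t), zpow_add₀ (by norm_num) t, neg_one_zpow_mul_self,
        mul_one, zpow_one, mul_neg_one]
    have e3 : (x * y) ^ (s + t + 1) * (x / y) ^ (s - t) = x * x ^ (2 * s) * y ^ (2 * t + 1) := by
      rw [hz, show (s + t + 1) + (s - t) = 1 + 2 * s by ring,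
        show (s + t + 1) - (s - t) = 2 * t + 1 by ring, zpow_one_add₀ hx]
    rw [e2, e1, zpow_sub₀ hr0 (2 * s ^ 2 + (2 * t ^ 2 + 2 * t)), zpow_add₀ hr0 (2 * s ^ 2)]
    have n1 := zpow_ne_zero ((s - t) ^ 2 - (s - t)) hr0
    calc _ = -((-1 : ℂ) ^ (s - t) * (-1) ^ (s - t)) * (r ^ (2 * s ^ 2) * r ^ (2 * t ^ 2 + 2 * t)) *
          ((x * y) ^ (s + t + 1) * (x / y) ^ (s - t)) := by field_simp
      _ = _ := by rw [neg_one_zpow_mul_self, e3]; ring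
  have p1 := summable_mul_of_summable_norm s1s.norm (s0 y hy).norm
  have p2 := summable_mul_of_summable_norm (s0 x hx).norm (s1 y hy).norm
  rw [Summable.tsum_sum]
  · rw [tsum_congr i1, tsum_congr i2, tsum_mul_left,
      ← tsum_mul_tsum_of_summable_norm s1s.norm (s0 y hy).norm,
      ← tsum_mul_tsum_of_summable_norm (s0 x hx).norm (s1 y hy).norm, ← s1']
    ring
  · exact p1.congr fun z => (i1 z).symm
  · exact (p2.mul_left (-x)).congr fun z => (i2 z).symm

/-- Weierstrass' three-term relation. -/
theorem ellTheta_weierstrass {p : ℂ} (hp : ‖p‖ < 1) {x y u v : ℂ} (hx : x ≠ 0) (hy : y ≠ 0)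
    (hu : u ≠ 0) (hv : v ≠ 0) :
    ellTheta p (x * y) * ellTheta p (x / y) * (ellTheta p (u * v) * ellTheta p (u / v)) -
      ellTheta p (x * v) * ellTheta p (x / v) * (ellTheta p (u * y) * ellTheta p (u / y)) =
    u / y * (ellTheta p (y * v) * ellTheta p (y / v) *
      (ellTheta p (x * u) * ellTheta p (x / u))) := by
  -- The series argument needs a nonzero square root r of p. For p = 0 the theta function is 1 - z
  -- and the relation is polynomial algebra.
  rcases eq_or_ne p 0 with rfl | hp0
  · have h : ∀ z : ℂ, ellTheta 0 z = 1 - z := fun z => by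
      rw [ellTheta, qFacInf_eq hp z, qFacInf]
      simp [qFacInf]
    simp only [h]
    field_simp
    ring
  · obtain ⟨r, rfl⟩ : ∃ r : ℂ, r ^ 2 = p := IsAlgClosed.exists_pow_nat_eq p two_pos
    have hr0 : r ≠ 0 := by rintro rfl; simp at hp0
    have hr1 : ‖r‖ < 1 := by
      rw [norm_pow] at hp
      exact lt_of_pow_lt_pow_left₀ 2 zero_le_one (by simpa using hp)
    obtain ⟨C₀, C₁, hC⟩ := exists_tsum_thetaTerm_mul hr0 hr1
    set K := (qFacInf (r ^ 2) (r ^ 2))⁻¹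
    -- With every product written as a 2×2 determinant in (C₀, C₁), what remains is the Plücker
    -- relation between the minors of a 2×4 matrix.
    have h : ∀ s t : ℂ, s ≠ 0 → t ≠ 0 → ellTheta (r ^ 2) (s * t) * ellTheta (r ^ 2) (s / t) =
        K ^ 2 * (s * (C₁ s * C₀ t - C₀ s * C₁ t)) := fun s t hs ht => by
      rw [ellTheta_eq_tsum hr0 hp (mul_ne_zero hs ht), ellTheta_eq_tsum hr0 hp (div_ne_zero hs ht),
        ← hC s t hs ht]
      ring
    rw [h x y hx hy, h u v hu hv, h x v hx hv, h u y hu hy, h y v hy hv, h x u hx hu]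
    field_simp
    ring

/-! ### Abstract theta functions and partial fractions -/

/-- The two properties of the modified theta function that elliptic hypergeometric identities
rest on: the reflection formula and Weierstrass' three-term relation. -/
structure IsThetaFun (θ : ℂ → ℂ) : Prop where
  inv : ∀ z, z ≠ 0 → θ z⁻¹ = -z⁻¹ * θ z
  weierstrass : ∀ x y u v, x ≠ 0 → y ≠ 0 → u ≠ 0 → v ≠ 0 →
    θ (x * y) * θ (x / y) * (θ (u * v) * θ (u / v)) -
      θ (x * v) * θ (x / v) * (θ (u * y) * θ (u / y)) =
    u / y * (θ (y * v) * θ (y / v) * (θ (x * u) * θ (x / u)))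

theorem isThetaFun_ellTheta {p : ℂ} (hp : ‖p‖ < 1) : IsThetaFun (ellTheta p) :=
  ⟨fun _ hz => ellTheta_inv hp hz, fun _ _ _ _ => ellTheta_weierstrass hp⟩

namespace IsThetaFun

variable {θ : ℂ → ℂ}

theorem one (hθ : IsThetaFun θ) : θ 1 = 0 := by
  have h := hθ.inv 1 one_ne_zero
  rw [inv_one] at h
  have : 2 * θ 1 = 0 := by linear_combination h
  simpa using this

theorem div_comm (hθ : IsThetaFun θ) {u v : ℂ} (hu : u ≠ 0) (hv : v ≠ 0) :
    θ (u / v) = -(u / v) * θ (v / u) := by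
  rw [← inv_div v u]
  exact hθ.inv _ (div_ne_zero hv hu)

theorem one_div (hθ : IsThetaFun θ) {u : ℂ} (hu : u ≠ 0) :
    θ (1 / u) = -(1 / u) * θ u := by
  rw [_root_.one_div]
  exact hθ.inv _ hu

theorem div_ne_zero_comm (hθ : IsThetaFun θ) {u v : ℂ} (hu : u ≠ 0) (hv : v ≠ 0)
    (h : θ (u / v) ≠ 0) : θ (v / u) ≠ 0 := by
  rw [hθ.div_comm hu hv] at h
  exact right_ne_zero_of_mul h

/-- The three-term relation in a form without square roots. -/
theorem three_term (hθ : IsThetaFun θ) {y a a' b' μ : ℂ} (hy : y ≠ 0) (ha : a ≠ 0) (ha' : a' ≠ 0)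
    (hb' : b' ≠ 0) (hμ : μ ≠ 0) :
    θ (μ * (a' / b')) * θ (y / b') * θ (y * μ / a) * θ (a / a') =
      θ μ * θ (y * (μ * (a' / b')) / a) * θ (a / b') * θ (y / a') -
        a / a' * θ (y * (μ * (a' / b')) / a') * θ (a' / b') * θ (y / a) * θ (a' * μ / a) := by
  -- Weierstrass' relation is applied at (ua'/b', μ/u, u, ua'/a). With u² = yμ/a', u occurs in all
  -- twelve theta arguments only through u² or cancels.
  obtain ⟨u, hu⟩ := IsAlgClosed.exists_pow_nat_eq (y * μ / a') two_pos
  have hu0 : u ≠ 0 := by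
    rintro rfl
    have : y * μ / a' ≠ 0 := by positivity
    simp at hu
    tauto
  have h := hθ.weierstrass (u * a' / b') (μ / u) u (u * a' / a) (by positivity) (by positivity)
    hu0 (by positivity)
  have hyv : y = u ^ 2 * a' / μ := by rw [hu]; field_simp
  have e1 : u * a' / b' * (μ / u) = μ * (a' / b') := by field_simp
  have e2 : u * a' / b' / (μ / u) = y / b' := by rw [hyv]; field_simp
  have e3 : u * (u * a' / a) = y * μ / a := by rw [hyv]; field_simp
  have e4 : u / (u * a' / a) = a / a' := by field_simp
  have e5 : u * a' / b' * (u * a' / a) = y * (μ * (a' / b')) / a := by rw [hyv]; field_simp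
  have e6 : u * a' / b' / (u * a' / a) = a / b' := by field_simp
  have e7 : u * (μ / u) = μ := by field_simp
  have e8 : u / (μ / u) = y / a' := by rw [hyv]; field_simp
  have e9 : μ / u * (u * a' / a) = a' * μ / a := by field_simp
  have e10 : μ / u / (u * a' / a) = a / y := by rw [hyv]; field_simp
  have e11 : u * a' / b' * u = y * (μ * (a' / b')) / a' := by rw [hyv]; field_simp
  have e12 : u * a' / b' / u = a' / b' := by field_simp
  rw [e1, e2, e3, e4, e5, e6, e7, e8, e9, e10, e11, e12, hθ.div_comm ha hy] at h
  have e13 : a / a' = y / a' * (a / y) := by field_simp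
  linear_combination h + θ (y * (μ * (a' / b')) / a') * θ (a' / b') * θ (y / a) *
    θ (a' * μ / a) * e13

variable {ι : Type*} [DecidableEq ι]

/-- The elliptic partial fraction expansion (Lagrange interpolation for theta functions). -/
theorem partial_fractions (hθ : IsThetaFun θ) {a b : ι → ℂ} (ha : ∀ i, a i ≠ 0)
    (hb : ∀ i, b i ≠ 0) (o : ι) (S : Finset ι) (ho : o ∉ S)
    (hd : ∀ i ∈ insert o S, ∀ j ∈ insert o S, i ≠ j → θ (a i / a j) ≠ 0)
    (hμ : ∀ S' ⊆ S, θ (∏ i ∈ insert o S', a i / b i) ≠ 0) {y : ℂ} (hy : y ≠ 0) :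
    θ (∏ i ∈ insert o S, a i / b i) * ∏ i ∈ insert o S, θ (y / b i) =
      ∑ l ∈ insert o S, θ (y * (∏ i ∈ insert o S, a i / b i) / a l) * (θ (a l / b l) *
        ∏ i ∈ (insert o S).erase l, θ (a l / b i) * (θ (y / a i) / θ (a l / a i))) := by
  induction S using Finset.induction_on generalizing y with
  | empty =>
    simp only [insert_empty_eq, prod_singleton, sum_singleton, erase_singleton, prod_empty]
    rw [show y * (a o / b o) / a o = y / b o by have := ha o; field_simp]
    ring
  -- The new index e is absorbed by using the induction hypothesis twice, at y and at y = a e. The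
  -- index o is kept throughout so that the index set is never empty.
  | insert e S heS ih =>
    have hoe : o ≠ e := fun h => ho (h ▸ mem_insert_self _ _)
    have hoS : o ∉ S := fun h => ho (mem_insert_of_mem h)
    have hsub : insert o S ⊆ insert o (insert e S) := insert_subset_insert _ (subset_insert _ _)
    have IH := fun {y : ℂ} (hy : y ≠ 0) => ih hoS
      (fun i hi j hj => hd i (hsub hi) j (hsub hj))
      (fun S' hS' => hμ S' (hS'.trans (subset_insert _ _))) hy
    have hμ0 := hμ S (subset_insert _ _)
    rw [Finset.insert_comm] at hd ⊢
    have heT : e ∉ insert o S := by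
      rw [mem_insert, not_or]; exact ⟨hoe.symm, heS⟩
    generalize insert o S = T at *
    have hμn : ∏ i ∈ T, a i / b i ≠ 0 :=
      prod_ne_zero_iff.mpr fun i _ => div_ne_zero (ha i) (hb i)
    rw [sum_insert heT, erase_insert heT, prod_insert heT, prod_insert heT]
    have hde : ∀ i ∈ T, θ (a e / a i) ≠ 0 := fun i hi => hd e (mem_insert_self _ _) i
      (mem_insert_of_mem hi) (fun h => heT (h ▸ hi))
    set μ := ∏ i ∈ T, a i / b i
    have IHy := IH hy
    have IHe := IH (ha e)
    set G : ι → ℂ → ℂ := fun l y => θ (a l / b l) *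
        ∏ i ∈ T.erase l, θ (a l / b i) * (θ (y / a i) / θ (a l / a i)) with hG
    have h1 : ∀ l ∈ T, θ (y * (a e / b e * μ) / a l) * (θ (a l / b l) *
        ∏ i ∈ (insert e T).erase l, θ (a l / b i) * (θ (y / a i) / θ (a l / a i))) =
        θ (y * (μ * (a e / b e)) / a l) * (θ (a l / b e) * (θ (y / a e) / θ (a l / a e))) *
          G l y := by
      intro l hl
      have hle : e ≠ l := fun h => heT (h ▸ hl)
      rw [erase_insert_of_ne hle, prod_insert (fun h => heT (mem_of_mem_erase h)),
        mul_comm (a e / b e)]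
      simp only [hG]
      ring
    rw [sum_congr rfl h1]
    -- Multiplying by ∏ θ(y/a_i)/θ(a_e/a_i) turns the expansion at a e into one with the same G l y
    -- as the expansion at y, so the two can be compared term by term.
    have h2 : ∀ l ∈ T, (∏ i ∈ T, θ (y / a i) / θ (a e / a i)) * G l (a e) =
        θ (y / a l) / θ (a e / a l) * G l y := by
      intro l hl
      rw [← mul_prod_erase T _ hl]
      simp only [hG]
      have : (∏ i ∈ T.erase l, θ (y / a i) / θ (a e / a i)) *
          ∏ i ∈ T.erase l, θ (a l / b i) * (θ (a e / a i) / θ (a l / a i)) =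
          ∏ i ∈ T.erase l, θ (a l / b i) * (θ (y / a i) / θ (a l / a i)) := by
        rw [← prod_mul_distrib]
        refine prod_congr rfl fun i hi => ?_
        have := hde i (mem_of_mem_erase hi)
        field_simp
      rw [← this]
      ring
    have h3 : θ μ * ∏ i ∈ T, θ (a e / b i) * (θ (y / a i) / θ (a e / a i)) =
        ∑ l ∈ T, θ (a e * μ / a l) * (θ (y / a l) / θ (a e / a l)) * G l y := by
      rw [prod_mul_distrib, ← mul_assoc, IHe, sum_mul]
      refine sum_congr rfl fun l hl => ?_
      rw [mul_assoc, mul_comm (_ * _) (∏ i ∈ T, _), mul_assoc, ← h2 l hl]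
    -- The step divides by θ(μ) for the set without e; this is why the partial products over all
    -- subsets are required to have nonzero theta value.
    refine mul_left_cancel₀ hμ0 ?_
    calc θ μ * (θ (a e / b e * μ) * (θ (y / b e) * ∏ i ∈ T, θ (y / b i)))
        = θ (μ * (a e / b e)) * θ (y / b e) * (θ μ * ∏ i ∈ T, θ (y / b i)) := by
          rw [mul_comm μ]; ring
      _ = ∑ l ∈ T, (θ (y * (μ * (a e / b e)) / a e) * θ (a e / b e) *
            (θ (a e * μ / a l) * (θ (y / a l) / θ (a e / a l)) * G l y) +
            θ μ * (θ (y * (μ * (a e / b e)) / a l) *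
              (θ (a l / b e) * (θ (y / a e) / θ (a l / a e))) * G l y)) := by
          rw [IHy, mul_sum]
          refine sum_congr rfl fun l hl => ?_
          have n1 := hde l hl
          have n2 := hθ.div_ne_zero_comm (ha e) (ha l) n1
          -- For each l separately, the three-term relation splits the term of the expansion at y
          -- into the new term for l and a contribution to the new term for e.
          have W := hθ.three_term hy (ha l) (ha e) (hb e) hμn
          have e1 : θ (a e / a l) = -(a e / a l) * θ (a l / a e) := hθ.div_comm (ha e) (ha l)
          have W' : θ (μ * (a e / b e)) * θ (y / b e) * θ (y * μ / a l) =
              θ (y * (μ * (a e / b e)) / a e) * θ (a e / b e) *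
              (θ (a e * μ / a l) * (θ (y / a l) / θ (a e / a l))) +
              θ μ * (θ (y * (μ * (a e / b e)) / a l) *
              (θ (a l / b e) * (θ (y / a e) / θ (a l / a e)))) := by
            rw [e1]
            have n3 := ha l
            have n4 := ha e
            generalize θ (a l / a e) = t at *
            generalize θ (y * (μ * (a e / b e)) / a e) = t1 at *
            generalize θ (y * (μ * (a e / b e)) / a l) = t2 at *
            generalize θ (μ * (a e / b e)) = t3 at *
            generalize θ (a e * μ / a l) = t4 at *
            generalize θ (y * μ / a l) = t5 at *
            generalize θ (a e / b e) = t6 at *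
            generalize θ (y / a l) = t7 at *
            generalize θ (y / a e) = t8 at *
            generalize θ (y / b e) = t9 at *
            generalize θ (a l / b e) = t10 at *
            field_simp at W ⊢
            linear_combination W
          linear_combination G l y * W'
      _ = _ := by
          rw [sum_add_distrib, ← mul_sum, ← mul_sum, ← h3, mul_comm (a e / b e) μ]
          ring

end IsThetaFun

namespace IsThetaFun

variable {θ : ℂ → ℂ}

/-- This is `three_term` with μ = 1/(kr) and b' = 1, cleared of reciprocals by reflection. In this
form Weierstrass' relation becomes the recurrence of the Jackson coefficients. -/
theorem three_term' (hθ : IsThetaFun θ) {k α r C : ℂ} (hk : k ≠ 0) (hα : α ≠ 0) (hr : r ≠ 0)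
    (hC : C ≠ 0) :
    θ k * θ C * θ (α / r) * θ (α * k * r / C) =
      θ α * θ (k * α / C) * θ (C / r) * θ (k * r) +
        k * α / C * θ (k * α) * θ (C / α) * θ r * θ (C / (k * r)) := by
  have h := hθ.three_term (y := C) (a := α) (a' := r) (b' := 1) (μ := 1 / (k * r)) hC hα hr
    one_ne_zero (one_div_ne_zero (mul_ne_zero hk hr))
  have e1 : 1 / (k * r) * (r / 1) = 1 / k := by field_simp
  have e2 : C * (1 / (k * r)) / α = 1 / (α * k * r / C) := by field_simp
  have e3 : C * (1 / k) / α = 1 / (k * α / C) := by field_simp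
  have e4 : C * (1 / k) / r = C / (k * r) := by field_simp
  have e5 : r * (1 / (k * r)) / α = 1 / (k * α) := by field_simp
  rw [e1, e2, e3, e4, e5, hθ.one_div hk, hθ.one_div (u := α * k * r / C) (by positivity),
    hθ.one_div (u := k * r) (by positivity), hθ.one_div (u := k * α / C) (by positivity),
    hθ.one_div (u := k * α) (by positivity)] at h
  simp only [div_one] at h
  generalize θ (k * α / C) = t1 at *
  generalize θ (α * k * r / C) = t2 at *
  generalize θ (C / (k * r)) = t3 at *
  generalize θ (C / r) = t4 at *
  generalize θ (C / α) = t5 at *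
  generalize θ (α / r) = t6 at *
  generalize θ (k * r) = t7 at *
  generalize θ (k * α) = t8 at *
  field_simp at h ⊢
  linear_combination h

variable {ι : Type*} [DecidableEq ι]

/-- Choosing b_o = B and b_i = x_i/s for i in V makes all the products of a_i/b_i geometric in s and
all the factors θ(x_l/b_l) with l in V equal to θ(s). It is used with s = q and with s = q⁻¹. -/
theorem partial_fractions_shift (hθ : IsThetaFun θ) {x : ι → ℂ} (hx : ∀ i, x i ≠ 0)
    (hd : ∀ i j, i ≠ j → θ (x i / x j) ≠ 0) {s B y : ℂ} (hs : s ≠ 0) (hB : B ≠ 0) (hy : y ≠ 0)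
    (o : ι) (V : Finset ι) (ho : o ∉ V) (hμ : ∀ k ≤ #V, θ (x o / B * s ^ k) ≠ 0) :
    θ (x o / B * s ^ #V) * (θ (y / B) * ∏ i ∈ V, θ (s * y / x i)) =
      θ (y * (x o / B * s ^ #V) / x o) * (θ (x o / B) *
        ∏ i ∈ V, θ (s * x o / x i) * (θ (y / x i) / θ (x o / x i))) +
      ∑ l ∈ V, θ (y * (x o / B * s ^ #V) / x l) * (θ s * (θ (x l / B) *
        (θ (y / x o) / θ (x l / x o)) *
        ∏ i ∈ V.erase l, θ (s * x l / x i) * (θ (y / x i) / θ (x l / x i)))) := by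
  set b : ι → ℂ := fun i => if i = o then B else x i / s with hbdef
  have hbo : b o = B := if_pos rfl
  have hbi : ∀ i, i ≠ o → b i = x i / s := fun i hi => if_neg hi
  have hb : ∀ i, b i ≠ 0 := fun i => by
    by_cases h : i = o
    · rw [h, hbo]; exact hB
    · rw [hbi i h]; exact div_ne_zero (hx i) hs
  have hne : ∀ i ∈ V, i ≠ o := fun i hi h => ho (h ▸ hi)
  have hprod : ∀ S ⊆ V, ∏ i ∈ insert o S, x i / b i = x o / B * s ^ #S := fun S hS => by
    rw [prod_insert (fun h => ho (hS h)), hbo, prod_congr rfl (g := fun _ => s), prod_const]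
    intro i hi
    rw [hbi i (hne i (hS hi))]
    have := hx i
    field_simp
  have h := hθ.partial_fractions hx hb o V ho (fun i _ j _ hij => hd i j hij)
    (fun S hS => by rw [hprod S hS]; exact hμ _ (card_le_card hS)) hy
  rw [hprod V Subset.rfl, prod_insert ho, sum_insert ho, erase_insert ho, hbo] at h
  have hq : ∀ u : ℂ, ∀ i ∈ V, θ (u / b i) = θ (s * u / x i) := fun u i hi => by
    rw [hbi i (hne i hi)]
    congr 1
    have := hx i
    field_simp
  have e1 : ∀ l ∈ V, θ (x l / b l) = θ s := fun l hl => by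
    rw [hq _ l hl]
    congr 1
    have := hx l
    field_simp
  rw [prod_congr rfl (hq y)] at h
  rw [h]
  congr 1
  · congr 2
    exact prod_congr rfl fun i hi => by rw [hq _ i hi]
  · refine sum_congr rfl fun l hl => ?_
    rw [erase_insert_of_ne (hne l hl).symm, prod_insert (fun h => ho (mem_of_mem_erase h)),
      e1 l hl, hbo]
    congr 3
    exact prod_congr rfl fun i hi => by rw [hq _ i (mem_of_mem_erase hi)]

end IsThetaFun

/-! ### Weights of decompositions and the exchange of a variable -/

section Weights

variable {ι : Type*} [DecidableEq ι]

/-- The interaction factor `∏_{i ∈ V, j ∈ W} θ(q x_j / x_i) / θ(x_j / x_i)`. -/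
noncomputable def crossProd (θ : ℂ → ℂ) (q : ℂ) (x : ι → ℂ) (V W : Finset ι) : ℂ :=
  ∏ i ∈ V, ∏ j ∈ W, θ (q * x j / x i) / θ (x j / x i)

/-- The weight of a decomposition of the set of variables into `V` and `W`. -/
noncomputable def subsetWeight (θ : ℂ → ℂ) (q : ℂ) (x : ι → ℂ) (a β η ζ : ℂ) (V W : Finset ι) : ℂ :=
  (∏ i ∈ V, x i * θ (β * x i) * θ (η / x i)) * (∏ j ∈ W, θ (a * x j * q) * θ (x j / ζ)) *
    crossProd θ q x V W

/-- The residue term through which the weights of `(insert l U, W)` and `(U, insert l W)`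
exchange the variable `x l` when the variable `x o` is added. -/
noncomputable def exchangeTerm (θ : ℂ → ℂ) (q : ℂ) (x : ι → ℂ) (o : ι) (a β η ζ D : ℂ)
    (U : Finset ι) (l : ι) (W : Finset ι) : ℂ :=
  θ q * (x o * θ (x o / ζ) * θ (η / x o)) * (θ (x l / (D * x o)) / θ (x l / x o)) *
    (θ (a * x l * q) * θ (β * x l)) * (∏ i ∈ U, θ (q * x l / x i) / θ (x l / x i)) *
    (∏ j ∈ W, θ (q * x j / x l) / θ (x j / x l)) * subsetWeight θ q x a β η ζ U W

theorem crossProd_insert_left (θ : ℂ → ℂ) (q : ℂ) (x : ι → ℂ) {V : Finset ι} (W : Finset ι) {o : ι}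
    (ho : o ∉ V) : crossProd θ q x (insert o V) W =
      (∏ j ∈ W, θ (q * x j / x o) / θ (x j / x o)) * crossProd θ q x V W := by
  rw [crossProd, prod_insert ho]; rfl

theorem crossProd_insert_right (θ : ℂ → ℂ) (q : ℂ) (x : ι → ℂ) (V : Finset ι) {W : Finset ι} {o : ι}
    (ho : o ∉ W) : crossProd θ q x V (insert o W) =
      (∏ i ∈ V, θ (q * x o / x i) / θ (x o / x i)) * crossProd θ q x V W := by
  simp_rw [crossProd, prod_insert ho, prod_mul_distrib]

namespace IsThetaFun

variable {θ : ℂ → ℂ}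

/-- Partial fractions in the variables V and o, with s = q, evaluated at y = η. The term of index o
is the weight to be expanded, the left-hand product shifts η to ηq, and the residues at l in V move
l across. The value of D is forced: it turns the factors θ(yμ/x_l) into θ(1/(a x_l q)), which
reflection converts to the factors θ(a x_l q) of the weight. -/
theorem subsetWeight_insert_right (hθ : IsThetaFun θ) {q : ℂ} (hq : q ≠ 0) {x : ι → ℂ}
    (hx : ∀ i, x i ≠ 0) (hd : ∀ i j, i ≠ j → θ (x i / x j) ≠ 0) {a β η ζ D : ℂ} (ha : a ≠ 0)
    (hη : η ≠ 0) (o : ι) (V W : Finset ι) (hoV : o ∉ V) (hoW : o ∉ W)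
    (hD : D = q ^ #V * a * η * q) (hnz : ∀ k ≤ #V, θ (q ^ k / D) ≠ 0) :
    θ (1 / D) * subsetWeight θ q x a β η ζ V (insert o W) =
      -(a * q * x o) * θ (1 / (a * η * q)) * θ (1 / (q ^ #V * q * a * x o)) * θ (x o / ζ) *
        subsetWeight θ q x a β (η * q) ζ V W -
      ∑ l ∈ V, exchangeTerm θ q x o a β η ζ D (V.erase l) l W := by
  have hD0 : D ≠ 0 := by rw [hD]; positivity
  have hxo := hx o
  have hk : ∀ k, x o / (D * x o) * q ^ k = q ^ k / D := fun k => by field_simp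
  have h := hθ.partial_fractions_shift hx hd (s := q) (B := D * x o) (y := η) hq
    (mul_ne_zero hD0 hxo) hη o V hoV (fun k hk' => by rw [hk]; exact hnz k hk')
  have e1 : x o / (D * x o) * q ^ #V = 1 / (a * η * q) := by rw [hD]; field_simp
  have e2 : η / (D * x o) = 1 / (q ^ #V * q * a * x o) := by rw [hD]; field_simp
  have e3 : ∀ l, η * (1 / (a * η * q)) / x l = 1 / (a * x l * q) := fun l => by
    have := hx l; field_simp
  have e4 : x o / (D * x o) = 1 / D := by field_simp
  have e5 : ∀ l, θ (1 / (a * x l * q)) = -(1 / (a * x l * q)) * θ (a * x l * q) := fun l =>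
    hθ.one_div (mul_ne_zero (mul_ne_zero ha (hx l)) hq)
  rw [e1, e2, e3, e4, e5] at h
  simp only [e3, e5] at h
  have hs : ∑ l ∈ V, exchangeTerm θ q x o a β η ζ D (V.erase l) l W =
      (∑ l ∈ V, -(1 / (a * x l * q)) * θ (a * x l * q) * (θ q * (θ (x l / (D * x o)) *
        (θ (η / x o) / θ (x l / x o)) *
        ∏ i ∈ V.erase l, θ (q * x l / x i) * (θ (η / x i) / θ (x l / x i))))) *
      (-(a * q * x o) * θ (x o / ζ) * (∏ i ∈ V, x i * θ (β * x i)) *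
        (∏ j ∈ W, θ (a * x j * q) * θ (x j / ζ)) * crossProd θ q x V W) := by
    rw [sum_mul]
    refine sum_congr rfl fun l hl => ?_
    have hxl := hx l
    have c : crossProd θ q x V W = (∏ j ∈ W, θ (q * x j / x l) / θ (x j / x l)) *
        crossProd θ q x (V.erase l) W := by
      rw [← crossProd_insert_left θ q x W (notMem_erase l V), insert_erase hl]
    rw [exchangeTerm, subsetWeight, c, ← mul_prod_erase V (fun i => x i * θ (β * x i)) hl,
      prod_mul_distrib (s := V.erase l) (f := fun i => x i * θ (β * x i))]
    have p1 : ∏ i ∈ V.erase l, θ (q * x l / x i) * (θ (η / x i) / θ (x l / x i)) =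
        (∏ i ∈ V.erase l, θ (q * x l / x i) / θ (x l / x i)) * ∏ i ∈ V.erase l, θ (η / x i) := by
      rw [← prod_mul_distrib]
      exact prod_congr rfl fun i _ => by ring
    rw [p1]
    generalize ∏ i ∈ V.erase l, x i * θ (β * x i) = P₁
    generalize ∏ i ∈ V.erase l, θ (η / x i) = P₂
    generalize ∏ i ∈ V.erase l, θ (q * x l / x i) / θ (x l / x i) = P₃
    generalize ∏ j ∈ W, θ (a * x j * q) * θ (x j / ζ) = P₄
    generalize ∏ j ∈ W, θ (q * x j / x l) / θ (x j / x l) = P₅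
    generalize crossProd θ q x (V.erase l) W = P₆
    generalize θ (x l / (D * x o)) = t₁
    generalize θ (x l / x o) = t₂
    generalize θ (a * x l * q) = t₃
    generalize θ (β * x l) = t₄
    generalize θ (η / x o) = t₅
    generalize θ (x o / ζ) = t₆
    have e : 1 / (a * x l * q) * (a * q * x l) = 1 := by field_simp
    generalize 1 / (a * x l * q) = u at e ⊢
    linear_combination -(θ q * (x o * t₆ * t₅) * (t₁ / t₂) * (t₃ * t₄) * P₃ * P₅ *
      (P₁ * P₂ * P₄ * P₆)) * e
  rw [hs]
  have p2 : ∏ i ∈ V, θ (q * x o / x i) * (θ (η / x i) / θ (x o / x i)) =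
      (∏ i ∈ V, θ (q * x o / x i) / θ (x o / x i)) * ∏ i ∈ V, θ (η / x i) := by
    rw [← prod_mul_distrib]
    exact prod_congr rfl fun i _ => by ring
  rw [p2] at h
  have p3 : ∏ i ∈ V, θ (q * η / x i) = ∏ i ∈ V, θ (η * q / x i) := by simp_rw [mul_comm q]
  rw [p3] at h
  rw [subsetWeight, subsetWeight, crossProd_insert_right _ _ _ _ hoW, prod_insert hoW,
    prod_mul_distrib (s := V) (f := fun i => x i * θ (β * x i)),
    prod_mul_distrib (s := V) (f := fun i => x i * θ (β * x i))]
  have e6 : θ (a * x o * q) = -(a * q * x o) * (-(1 / (a * x o * q)) * θ (a * x o * q)) := by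
    generalize θ (a * x o * q) = t
    field_simp
  rw [e6]
  generalize -(1 / (a * x o * q)) * θ (a * x o * q) = t at *
  linear_combination (a * q * x o) * θ (x o / ζ) * (∏ i ∈ V, x i * θ (β * x i)) *
        (∏ j ∈ W, θ (a * x j * q) * θ (x j / ζ)) * crossProd θ q x V W * h

/-- The mirror image of `subsetWeight_insert_right`: partial fractions in the variables W and o with
s = q⁻¹, at y = ζq. Now D is fixed so that the factors θ(β x_l) appear, and the residues are again
exchange terms but with the opposite sign. -/
theorem subsetWeight_insert_left (hθ : IsThetaFun θ) {q : ℂ} (hq : q ≠ 0) {x : ι → ℂ}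
    (hx : ∀ i, x i ≠ 0) (hd : ∀ i j, i ≠ j → θ (x i / x j) ≠ 0) {a β η ζ D : ℂ} (hβ : β ≠ 0)
    (hζ : ζ ≠ 0) (o : ι) (V W : Finset ι) (hoV : o ∉ V) (hoW : o ∉ W) (hD0 : D ≠ 0)
    (hD : D * q ^ #W = β * (ζ * q)) (hnz : ∀ k ≤ #W, θ (1 / (D * q ^ k)) ≠ 0) :
    θ (1 / D) * subsetWeight θ q x a β η (ζ * q) (insert o V) W =
      -(β * x o ^ 2) * θ (η / x o) * θ (1 / (β * (ζ * q))) * θ (ζ * q / (D * x o)) *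
        subsetWeight θ q x a β η ζ V W +
      ∑ l ∈ W, exchangeTerm θ q x o a β η (ζ * q) D V l (W.erase l) := by
  have hxo := hx o
  have hk : ∀ k, x o / (D * x o) * q⁻¹ ^ k = 1 / (D * q ^ k) := fun k => by
    rw [inv_pow]; field_simp
  have h := hθ.partial_fractions_shift hx hd (s := q⁻¹) (B := D * x o) (y := ζ * q)
    (inv_ne_zero hq) (mul_ne_zero hD0 hxo) (mul_ne_zero hζ hq) o W hoW
    (fun k hk' => by rw [hk]; exact hnz k hk')
  rw [hk, hD] at h
  have e3 : ∀ l, ζ * q * (1 / (β * (ζ * q))) / x l = 1 / (β * x l) := fun l => by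
    have := hx l; field_simp
  have e4 : x o / (D * x o) = 1 / D := by field_simp
  have e5 : ∀ l, θ (1 / (β * x l)) = -(1 / (β * x l)) * θ (β * x l) := fun l =>
    hθ.one_div (mul_ne_zero hβ (hx l))
  have e6 : ∀ i, θ (q⁻¹ * (ζ * q) / x i) = -(ζ / x i) * θ (x i / ζ) := fun i => by
    rw [show q⁻¹ * (ζ * q) / x i = ζ / x i by field_simp, hθ.div_comm hζ (hx i)]
  -- Reflection returns the shifts by q⁻¹ to shifts by q. The price is a factor -(ζ/x_i) for each i;
  -- these are collected in P and cancelled from the whole identity.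
  have e7 : ∀ u i, u ≠ i → θ (q⁻¹ * x u / x i) * (θ (ζ * q / x i) / θ (x u / x i)) =
      -(ζ / x i) * (θ (q * x i / x u) / θ (x i / x u) * θ (x i / (ζ * q))) := fun u i hui => by
    have n1 := hx u
    have n2 := hx i
    have n3 := hd i u hui.symm
    rw [show q⁻¹ * x u / x i = x u / (q * x i) by field_simp,
      hθ.div_comm n1 (mul_ne_zero hq n2), hθ.div_comm (mul_ne_zero hζ hq) n2, hθ.div_comm n1 n2]
    field_simp
  have e8 : θ q⁻¹ = -q⁻¹ * θ q := hθ.inv q hq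
  have e9 : θ (ζ * q / x o) = -(ζ * q / x o) * θ (x o / (ζ * q)) :=
    hθ.div_comm (mul_ne_zero hζ hq) hxo
  have hne : ∀ i ∈ W, o ≠ i := fun i hi h => hoW (h ▸ hi)
  rw [e3, e4, e5, e8, e9] at h
  simp only [e3, e5, e6] at h
  have p1 : ∏ i ∈ W, θ (q⁻¹ * x o / x i) * (θ (ζ * q / x i) / θ (x o / x i)) =
      (∏ i ∈ W, -(ζ / x i)) * ((∏ i ∈ W, θ (q * x i / x o) / θ (x i / x o)) *
        ∏ i ∈ W, θ (x i / (ζ * q))) := by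
    rw [← prod_mul_distrib, ← prod_mul_distrib]
    exact prod_congr rfl fun i hi => e7 o i (hne i hi)
  rw [p1, prod_mul_distrib] at h
  have hP : ∏ i ∈ W, -(ζ / x i) ≠ 0 :=
    prod_ne_zero_iff.mpr fun i _ => neg_ne_zero.mpr (div_ne_zero hζ (hx i))
  set P := ∏ i ∈ W, -(ζ / x i) with hPdef
  have hs : ∑ l ∈ W, -(1 / (β * x l)) * θ (β * x l) * (-q⁻¹ * θ q * (θ (x l / (D * x o)) *
        (-(ζ * q / x o) * θ (x o / (ζ * q)) / θ (x l / x o)) *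
        ∏ i ∈ W.erase l, θ (q⁻¹ * x l / x i) * (θ (ζ * q / x i) / θ (x l / x i)))) =
      P * ∑ l ∈ W, 1 / (β * x o) * θ (β * x l) * (θ q * (θ (x l / (D * x o)) *
        (θ (x o / (ζ * q)) / θ (x l / x o)) *
        ((∏ i ∈ W.erase l, θ (q * x i / x l) / θ (x i / x l)) *
          ∏ i ∈ W.erase l, θ (x i / (ζ * q))))) := by
    rw [mul_sum]
    refine sum_congr rfl fun l hl => ?_
    have hxl := hx l
    rw [prod_congr rfl fun i hi => e7 l i (ne_of_mem_erase hi).symm, prod_mul_distrib,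
      prod_mul_distrib, hPdef, ← mul_prod_erase W (fun i => -(ζ / x i)) hl]
    generalize ∏ i ∈ W.erase l, -(ζ / x i) = P₁
    generalize ∏ i ∈ W.erase l, θ (q * x i / x l) / θ (x i / x l) = P₂
    generalize ∏ i ∈ W.erase l, θ (x i / (ζ * q)) = P₃
    generalize θ (x l / (D * x o)) = t₁
    generalize θ (x l / x o) = t₂
    generalize θ (β * x l) = t₃
    generalize θ (x o / (ζ * q)) = t₄
    generalize x l = X at *
    generalize x o = Y at *
    field_simp
  rw [hs] at h
  have h' := mul_left_cancel₀ hP (a := P) (b := θ (1 / (β * (ζ * q))) * (θ (ζ * q / (D * x o)) *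
      ∏ i ∈ W, θ (x i / ζ))) (c := -(1 / (β * x o)) * θ (β * x o) * (θ (1 / D) *
      ((∏ i ∈ W, θ (q * x i / x o) / θ (x i / x o)) * ∏ i ∈ W, θ (x i / (ζ * q)))) +
      ∑ l ∈ W, 1 / (β * x o) * θ (β * x l) * (θ q * (θ (x l / (D * x o)) *
        (θ (x o / (ζ * q)) / θ (x l / x o)) *
        ((∏ i ∈ W.erase l, θ (q * x i / x l) / θ (x i / x l)) *
          ∏ i ∈ W.erase l, θ (x i / (ζ * q))))))
    (by linear_combination h)
  have hs2 : ∑ l ∈ W, exchangeTerm θ q x o a β η (ζ * q) D V l (W.erase l) =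
      (∑ l ∈ W, 1 / (β * x o) * θ (β * x l) * (θ q * (θ (x l / (D * x o)) *
        (θ (x o / (ζ * q)) / θ (x l / x o)) *
        ((∏ i ∈ W.erase l, θ (q * x i / x l) / θ (x i / x l)) *
          ∏ i ∈ W.erase l, θ (x i / (ζ * q)))))) *
      (β * x o ^ 2 * θ (η / x o) * (∏ i ∈ V, x i * θ (β * x i) * θ (η / x i)) *
        (∏ j ∈ W, θ (a * x j * q)) * crossProd θ q x V W) := by
    rw [sum_mul]
    refine sum_congr rfl fun l hl => ?_
    have hxl := hx l
    have c : crossProd θ q x V W = (∏ i ∈ V, θ (q * x l / x i) / θ (x l / x i)) *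
        crossProd θ q x V (W.erase l) := by
      rw [← crossProd_insert_right θ q x V (notMem_erase l W), insert_erase hl]
    rw [exchangeTerm, subsetWeight, c, ← mul_prod_erase W (fun j => θ (a * x j * q)) hl,
      prod_mul_distrib (s := W.erase l) (f := fun j => θ (a * x j * q))]
    generalize ∏ i ∈ V, x i * θ (β * x i) * θ (η / x i) = P₁
    generalize ∏ i ∈ W.erase l, θ (q * x i / x l) / θ (x i / x l) = P₂
    generalize ∏ i ∈ W.erase l, θ (x i / (ζ * q)) = P₃
    generalize ∏ j ∈ W.erase l, θ (a * x j * q) = P₄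
    generalize ∏ i ∈ V, θ (q * x l / x i) / θ (x l / x i) = P₅
    generalize crossProd θ q x V (W.erase l) = P₆
    generalize θ (x l / (D * x o)) = t₁
    generalize θ (x l / x o) = t₂
    generalize θ (β * x l) = t₃
    generalize θ (x o / (ζ * q)) = t₄
    generalize θ (a * x l * q) = t₅
    generalize θ (η / x o) = t₆
    have e : 1 / (β * x o) * (β * x o) = 1 := by field_simp
    generalize 1 / (β * x o) = u at e ⊢
    linear_combination -(θ q * (x o * t₄ * t₆) * (t₁ / t₂) * (t₅ * t₃) * P₅ * P₂ *
      (P₁ * (P₄ * P₃) * P₆)) * e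
  rw [hs2, subsetWeight, subsetWeight, crossProd_insert_left _ _ _ _ hoV, prod_insert hoV,
    prod_mul_distrib (s := W) (f := fun j => θ (a * x j * q)),
    prod_mul_distrib (s := W) (f := fun j => θ (a * x j * q))]
  have e10 : θ (β * x o) = -(β * x o) * (-(1 / (β * x o)) * θ (β * x o)) := by
    generalize θ (β * x o) = t
    field_simp
  rw [e10]
  generalize -(1 / (β * x o)) * θ (β * x o) = t at *
  linear_combination (β * x o ^ 2 * θ (η / x o) * (∏ i ∈ V, x i * θ (β * x i) * θ (η / x i)) *
        (∏ j ∈ W, θ (a * x j * q)) * crossProd θ q x V W) * h'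

end IsThetaFun

end Weights

/-! ### The elliptic Jackson summation over subsets -/

/-- The shifted factorial `∏_{j < k} θ(z q ^ j)` attached to a function `θ`. -/
noncomputable def shiftedFac (θ : ℂ → ℂ) (q z : ℂ) (k : ℕ) : ℂ := ∏ j ∈ range k, θ (z * q ^ j)

theorem shiftedFac_succ (θ : ℂ → ℂ) (q z : ℂ) (k : ℕ) :
    shiftedFac θ q z (k + 1) = shiftedFac θ q z k * θ (z * q ^ k) := by
  rw [shiftedFac, prod_range_succ]; rfl

theorem shiftedFac_succ' (θ : ℂ → ℂ) (q z : ℂ) (k : ℕ) :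
    shiftedFac θ q z (k + 1) = θ z * shiftedFac θ q (z * q) k := by
  rw [shiftedFac, prod_range_succ', pow_zero, mul_one, mul_comm]
  simp_rw [shiftedFac, pow_succ', mul_assoc]

/-- The coefficient of the subsets of size `m` in the subset form of the Jackson summation. -/
noncomputable def subsetCoeff (θ : ℂ → ℂ) (q b c ρ₁ ρ₂ : ℂ) (M m : ℕ) : ℂ :=
  θ (c * q ^ (2 * m)) / shiftedFac θ q (c * q ^ m) (M + 1) * ((b / c) ^ m / q ^ m.choose 2) *
    (shiftedFac θ q ρ₁ m * shiftedFac θ q ρ₂ m *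
      (shiftedFac θ q (c * q ^ (m + 1) / ρ₁) (M - m) *
        shiftedFac θ q (c * q ^ (m + 1) / ρ₂) (M - m)))

/-- The bijection (S, l) ↦ (S \ {l}, l). The numerical argument of F is the size of S before the
removal, hence #S on one side and #S + 1 on the other. -/
theorem sum_powerset_exchange {ι : Type*} [DecidableEq ι] (X : Finset ι)
    (F : ℕ → Finset ι → ι → Finset ι → ℂ) :
    ∑ S ∈ X.powerset, ∑ l ∈ S, F #S (S.erase l) l (X \ S) =
      ∑ S ∈ X.powerset, ∑ l ∈ X \ S, F (#S + 1) S l ((X \ S).erase l) := by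
  rw [sum_sigma', sum_sigma']
  refine sum_bij' (fun s _ => ⟨s.1.erase s.2, s.2⟩) (fun s _ => ⟨insert s.2 s.1, s.2⟩) ?_ ?_ ?_ ?_ ?_
  · rintro ⟨S, l⟩ h
    simp only [mem_sigma, mem_powerset] at h ⊢
    exact ⟨(erase_subset _ _).trans h.1, mem_sdiff.mpr ⟨h.1 h.2, notMem_erase _ _⟩⟩
  · rintro ⟨S, l⟩ h
    simp only [mem_sigma, mem_powerset, mem_sdiff] at h ⊢
    exact ⟨insert_subset h.2.1 h.1, mem_insert_self _ _⟩
  · rintro ⟨S, l⟩ h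
    simp only [mem_sigma] at h
    simp only [insert_erase h.2]
  · rintro ⟨S, l⟩ h
    simp only [mem_sigma, mem_sdiff] at h
    simp only [erase_insert h.2.2]
  · rintro ⟨S, l⟩ h
    simp only [mem_sigma, mem_powerset] at h
    rw [card_erase_add_one h.2]
    congr 1
    ext i
    simp only [mem_sdiff, mem_erase]
    by_cases hi : i = l
    · simp [hi, h.2]
    · simp [hi]

namespace IsThetaFun

variable {θ : ℂ → ℂ}

/-- After common factors are removed this is `three_term'`. The balancing condition h expresses b/a
through c, ρ₁ and ρ₂, which makes the factors with ρ₂ appear although only ρ₁ is substituted. It is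
the condition under which the two contributions of a new point x combine to a multiple of the
coefficient for (bq, cq). -/
theorem subsetCoeff_recurrence (hθ : IsThetaFun θ) {q a b c ρ₁ ρ₂ x : ℂ} (hq : q ≠ 0) (ha : a ≠ 0)
    (hb : b ≠ 0) (hc : c ≠ 0) (hρ₁ : ρ₁ ≠ 0) (hρ₂ : ρ₂ ≠ 0) (hx : x ≠ 0)
    (h : ρ₁ * ρ₂ * b = c * q * a) (hnz : ∀ k : ℕ, θ (c * q ^ k) ≠ 0) (M m : ℕ) (hm : m ≤ M) :
    subsetCoeff θ q b c ρ₁ ρ₂ (M + 1) m / θ (1 / (c * q ^ (2 * m))) *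
        (-(a * q * x) * θ (1 / (c * q ^ m)) * θ (1 / (q ^ m * q * a * x)) *
          θ (x / (c * q ^ m / b))) +
      subsetCoeff θ q b c ρ₁ ρ₂ (M + 1) (m + 1) / θ (1 / (c * q ^ (2 * (m + 1)))) *
        (-(b * q ^ (M + 1) * x ^ 2) * θ (c * q ^ m / a / x) * θ (1 / (c * q ^ (M + m + 2))) *
          θ (1 / (b * q ^ (m + 1) * x))) =
    θ (b / a) * (θ (a * x * q / ρ₁) * θ (a * x * q / ρ₂)) *
      subsetCoeff θ q (b * q) (c * q) ρ₁ ρ₂ M m := by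
  have key := hθ.three_term' (k := b / a) (C := c * q ^ (2 * m + 1)) (α := a * x * q ^ (m + 1))
    (r := ρ₁ * q ^ m) (div_ne_zero hb ha) (by positivity) (by positivity) (by positivity)
  have e1 : a * x * q ^ (m + 1) / (ρ₁ * q ^ m) = a * x * q / ρ₁ := by
    field_simp
    ring
  have hbs : b = c * q * a / (ρ₁ * ρ₂) := by field_simp; linear_combination h
  have e2 : a * x * q ^ (m + 1) * (b / a) * (ρ₁ * q ^ m) / (c * q ^ (2 * m + 1)) =
      a * x * q / ρ₂ := by
    rw [hbs]; field_simp; ring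
  have e3 : b / a * (a * x * q ^ (m + 1)) / (c * q ^ (2 * m + 1)) = x / (c * q ^ m / b) := by
    field_simp; ring
  have e4 : c * q ^ (2 * m + 1) / (ρ₁ * q ^ m) = c * q ^ (m + 1) / ρ₁ := by
    field_simp; ring
  have e5 : b / a * (ρ₁ * q ^ m) = c * q ^ (m + 1) / ρ₂ := by
    rw [hbs]; field_simp; ring
  have e6 : b / a * (a * x * q ^ (m + 1)) = b * q ^ (m + 1) * x := by
    field_simp
  have e7 : c * q ^ (2 * m + 1) / (a * x * q ^ (m + 1)) = c * q ^ m / a / x := by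
    field_simp; ring
  have e8 : c * q ^ (2 * m + 1) / (c * q ^ (m + 1) / ρ₂) = ρ₂ * q ^ m := by
    field_simp; ring
  rw [e1, e2, e3, e4, e5, e6, e7, e8] at key
  have f1 : θ (1 / (c * q ^ (2 * m))) = -(1 / (c * q ^ (2 * m))) * θ (c * q ^ (2 * m)) :=
    hθ.one_div (by positivity)
  have f2 : θ (1 / (c * q ^ m)) = -(1 / (c * q ^ m)) * θ (c * q ^ m) := hθ.one_div (by positivity)
  have f3 : θ (1 / (q ^ m * q * a * x)) = -(1 / (a * x * q ^ (m + 1))) * θ (a * x * q ^ (m + 1)) := by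
    rw [show q ^ m * q * a * x = a * x * q ^ (m + 1) by ring]
    exact hθ.one_div (by positivity)
  have f4 : θ (1 / (c * q ^ (2 * (m + 1)))) =
      -(1 / (c * q ^ (2 * (m + 1)))) * θ (c * q ^ (2 * (m + 1))) := hθ.one_div (by positivity)
  have f5 : θ (1 / (c * q ^ (M + m + 2))) = -(1 / (c * q ^ (M + m + 2))) * θ (c * q ^ (M + m + 2)) :=
    hθ.one_div (by positivity)
  have f6 : θ (1 / (b * q ^ (m + 1) * x)) = -(1 / (b * q ^ (m + 1) * x)) * θ (b * q ^ (m + 1) * x) :=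
    hθ.one_div (by positivity)
  have g1 : shiftedFac θ q (c * q ^ m) (M + 1 + 1) =
      θ (c * q ^ m) * shiftedFac θ q (c * q ^ (m + 1)) (M + 1) := by
    rw [shiftedFac_succ', pow_succ, mul_assoc]
  have g2 : shiftedFac θ q (c * q ^ (m + 1)) (M + 1 + 1) =
      shiftedFac θ q (c * q ^ (m + 1)) (M + 1) * θ (c * q ^ (M + m + 2)) := by
    rw [shiftedFac_succ]
    congr 2
    ring
  have g3 : ∀ ρ, shiftedFac θ q (c * q ^ (m + 1) / ρ) (M + 1 - m) =
      θ (c * q ^ (m + 1) / ρ) * shiftedFac θ q (c * q ^ (m + 1 + 1) / ρ) (M - m) := fun ρ => by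
    rw [show M + 1 - m = M - m + 1 by omega, shiftedFac_succ', pow_succ q (m + 1)]
    congr 2
    ring
  have g4 : (m + 1).choose 2 = m + m.choose 2 := by
    rw [Nat.choose_succ_succ' m 1, Nat.choose_one_right]
  have g5 : ∀ k : ℕ, c * q * q ^ k = c * q ^ (k + 1) := fun k => by ring
  have g6 : b * q / (c * q) = b / c := by field_simp
  have n1 := hnz m
  have n2 := hnz (2 * m)
  have n3 := hnz (2 * (m + 1))
  have n4 := hnz (M + m + 2)
  rw [subsetCoeff, subsetCoeff, subsetCoeff, f1, f2, f3, f4, f5, f6, g1, g2, g3, g3,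
    shiftedFac_succ θ q ρ₁ m, shiftedFac_succ θ q ρ₂ m, g4, Nat.add_sub_add_right,
    pow_add q m (m.choose 2)]
  simp only [g5, g6]
  have hl : (-(a * q * x) * (-(1 / (c * q ^ m)) * θ (c * q ^ m)) *
      (-(1 / (a * x * q ^ (m + 1))) * θ (a * x * q ^ (m + 1))) * θ (x / (c * q ^ m / b))) /
      (-(1 / (c * q ^ (2 * m))) * θ (c * q ^ (2 * m))) * (θ (c * q ^ (2 * m)) / θ (c * q ^ m)) =
      θ (a * x * q ^ (m + 1)) * θ (x / (c * q ^ m / b)) := by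
    generalize θ (a * x * q ^ (m + 1)) = t₁
    generalize θ (x / (c * q ^ m / b)) = t₂
    field_simp
    ring
  have hr : (-(b * q ^ (M + 1) * x ^ 2) * θ (c * q ^ m / a / x) *
      (-(1 / (c * q ^ (M + m + 2))) * θ (c * q ^ (M + m + 2))) *
      (-(1 / (b * q ^ (m + 1) * x)) * θ (b * q ^ (m + 1) * x))) /
      (-(1 / (c * q ^ (2 * (m + 1)))) * θ (c * q ^ (2 * (m + 1)))) *
      (θ (c * q ^ (2 * (m + 1))) / θ (c * q ^ (M + m + 2))) * (b / c / q ^ m) =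
      x / (c * q ^ m / b) * θ (b * q ^ (m + 1) * x) * θ (c * q ^ m / a / x) := by
    generalize θ (b * q ^ (m + 1) * x) = t₁
    generalize θ (c * q ^ m / a / x) = t₂
    field_simp
    ring
  generalize shiftedFac θ q (c * q ^ (m + 1)) (M + 1) = s₁ at *
  generalize shiftedFac θ q (c * q ^ (m + 1 + 1) / ρ₁) (M - m) = s₂
  generalize shiftedFac θ q (c * q ^ (m + 1 + 1) / ρ₂) (M - m) = s₃
  generalize shiftedFac θ q ρ₁ m = s₄
  generalize shiftedFac θ q ρ₂ m = s₅
  generalize q ^ m.choose 2 = u at *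
  have key' : θ (a * x * q ^ (m + 1)) * θ (x / (c * q ^ m / b)) *
      (θ (c * q ^ (m + 1) / ρ₁) * θ (c * q ^ (m + 1) / ρ₂)) +
      x / (c * q ^ m / b) * θ (b * q ^ (m + 1) * x) * θ (c * q ^ m / a / x) *
        (θ (ρ₁ * q ^ m) * θ (ρ₂ * q ^ m)) =
      θ (b / a) * θ (c * q ^ (2 * m + 1)) * (θ (a * x * q / ρ₁) * θ (a * x * q / ρ₂)) := by
    linear_combination -key
  rw [← hl, ← hr] at key'
  linear_combination (1 / s₁ * ((b / c) ^ m / u) * (s₄ * s₅ * (s₂ * s₃))) * key'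

variable {ι : Type*} [DecidableEq ι]

/-- The elliptic Jackson summation in subset form. -/
theorem sum_subsetCoeff_mul_subsetWeight (hθ : IsThetaFun θ) {q a ρ₁ ρ₂ : ℂ} {x : ι → ℂ}
    (hq : q ≠ 0) (ha : a ≠ 0) (hρ₁ : ρ₁ ≠ 0) (hρ₂ : ρ₂ ≠ 0) (hx : ∀ i, x i ≠ 0)
    (hd : ∀ i j, i ≠ j → θ (x i / x j) ≠ 0) (X : Finset ι) :
    ∀ b c : ℂ, b ≠ 0 → c ≠ 0 → ρ₁ * ρ₂ * b = c * q * a → (∀ k : ℕ, θ (c * q ^ k) ≠ 0) →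
    ∑ S ∈ X.powerset, subsetCoeff θ q b c ρ₁ ρ₂ #X #S *
        subsetWeight θ q x a (b * q ^ #X) (c * q ^ #S / (a * q)) (c * q ^ #S / b) S (X \ S) =
      shiftedFac θ q (b / a) #X * ∏ i ∈ X, θ (a * x i * q / ρ₁) * θ (a * x i * q / ρ₂) := by
  induction X using Finset.induction_on with
  | empty =>
    intro b c _ _ _ hnz
    have := hnz 0
    rw [pow_zero, mul_one] at this
    simp [subsetCoeff, subsetWeight, crossProd, shiftedFac, this]
  | insert o X ho ih =>
    intro b c hb hc h hnz
    have IH := ih (b * q) (c * q) (mul_ne_zero hb hq) (mul_ne_zero hc hq)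
      (by linear_combination q * h) (fun k => by rw [mul_assoc, ← pow_succ']; exact hnz _)
    rw [sum_powerset_insert ho, card_insert_of_notMem ho, prod_insert ho, shiftedFac_succ',
      div_mul_eq_mul_div]
    set M := #X
    have hnz' : ∀ k : ℕ, θ (1 / (c * q ^ k)) ≠ 0 := fun k => by
      rw [hθ.one_div (mul_ne_zero hc (pow_ne_zero _ hq))]
      refine mul_ne_zero (neg_ne_zero.mpr (one_div_ne_zero ?_)) (hnz k)
      exact mul_ne_zero hc (pow_ne_zero _ hq)
    -- Both expansions carry the factor θ(1/D) with D = c q^{2m}, where m is the size of the left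
    -- part, o included if it belongs there. Together with η = c q^m/(aq) and ζ = c q^m/b this makes
    -- the exchange terms of the two cases literally the same function F.
    let K : ℕ → ℂ := fun m => subsetCoeff θ q b c ρ₁ ρ₂ (M + 1) m / θ (1 / (c * q ^ (2 * m)))
    let F : ℕ → Finset ι → ι → Finset ι → ℂ := fun m U l W => K m *
      exchangeTerm θ q x o a (b * q ^ (M + 1)) (c * q ^ m / (a * q)) (c * q ^ m / b)
        (c * q ^ (2 * m)) U l W
    let T : Finset ι → ℂ := fun S => subsetWeight θ q x a (b * q * q ^ M)
      (c * q * q ^ #S / (a * q)) (c * q * q ^ #S / (b * q)) S (X \ S)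
    have h1 : ∀ S ∈ X.powerset, subsetCoeff θ q b c ρ₁ ρ₂ (M + 1) #S *
        subsetWeight θ q x a (b * q ^ (M + 1)) (c * q ^ #S / (a * q)) (c * q ^ #S / b) S
          (insert o X \ S) =
        K #S * (-(a * q * x o) * θ (1 / (c * q ^ #S)) * θ (1 / (q ^ #S * q * a * x o)) *
          θ (x o / (c * q ^ #S / b))) * T S - ∑ l ∈ S, F #S (S.erase l) l (X \ S) := by
      intro S hS
      have hS := mem_powerset.mp hS
      have hoS : o ∉ S := fun h => ho (hS h)
      have hL := hθ.subsetWeight_insert_right hq hx hd (a := a) (β := b * q ^ (M + 1))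
        (η := c * q ^ #S / (a * q)) (ζ := c * q ^ #S / b) (D := c * q ^ (2 * #S)) ha
        (by positivity) o S (X \ S) hoS (fun h => ho (mem_sdiff.mp h).1)
        (by field_simp; ring)
        (fun k hk => by
          rw [show q ^ k / (c * q ^ (2 * #S)) = 1 / (c * q ^ (2 * #S - k)) by
            rw [show q ^ (2 * #S) = q ^ (2 * #S - k) * q ^ k by rw [← pow_add]; congr 1; omega]
            field_simp]
          exact hnz' _)
      have e1 : 1 / (a * (c * q ^ #S / (a * q)) * q) = 1 / (c * q ^ #S) := by field_simp
      have e2 : c * q ^ #S / (a * q) * q = c * q * q ^ #S / (a * q) := by ring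
      have e3 : c * q ^ #S / b = c * q * q ^ #S / (b * q) := by field_simp
      have e4 : T S = subsetWeight θ q x a (b * q ^ (M + 1)) (c * q * q ^ #S / (a * q))
          (c * q ^ #S / b) S (X \ S) := by
        rw [e3, show b * q ^ (M + 1) = b * q * q ^ M by ring]
      have e5 : ∑ l ∈ S, F #S (S.erase l) l (X \ S) = K #S * ∑ l ∈ S,
          exchangeTerm θ q x o a (b * q ^ (M + 1)) (c * q ^ #S / (a * q)) (c * q ^ #S / b)
            (c * q ^ (2 * #S)) (S.erase l) l (X \ S) := by
        rw [mul_sum]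
      rw [e1, e2, ← e4] at hL
      rw [e5, insert_sdiff_of_notMem _ hoS, mul_assoc (K #S), ← mul_sub, ← hL, ← mul_assoc]
      congr 1
      exact (div_mul_cancel₀ _ (hnz' _)).symm
    have h2 : ∀ S ∈ X.powerset, subsetCoeff θ q b c ρ₁ ρ₂ (M + 1) #(insert o S) *
        subsetWeight θ q x a (b * q ^ (M + 1)) (c * q ^ #(insert o S) / (a * q))
          (c * q ^ #(insert o S) / b) (insert o S) (insert o X \ insert o S) =
        K (#S + 1) * (-(b * q ^ (M + 1) * x o ^ 2) * θ (c * q ^ #S / a / x o) *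
          θ (1 / (c * q ^ (M + #S + 2))) * θ (1 / (b * q ^ (#S + 1) * x o))) * T S +
          ∑ l ∈ X \ S, F (#S + 1) S l ((X \ S).erase l) := by
      intro S hS
      have hS := mem_powerset.mp hS
      have hoS : o ∉ S := fun h => ho (hS h)
      have hxo := hx o
      have hcard : #(X \ S) + #S = M := card_sdiff_add_card_eq_card hS
      have hL := hθ.subsetWeight_insert_left hq hx hd (a := a) (β := b * q ^ (M + 1))
        (η := c * q ^ (#S + 1) / (a * q)) (ζ := c * q ^ #S / b) (D := c * q ^ (2 * (#S + 1)))
        (by positivity) (by positivity) o S (X \ S) hoS (fun h => ho (mem_sdiff.mp h).1)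
        (by positivity)
        (by rw [← hcard]; field_simp; ring)
        (fun k hk => by
          rw [mul_assoc, ← pow_add]
          exact hnz' _)
      have e0 : c * q ^ #S / b * q = c * q ^ (#S + 1) / b := by ring
      have e1 : 1 / (b * q ^ (M + 1) * (c * q ^ (#S + 1) / b)) = 1 / (c * q ^ (M + #S + 2)) := by
        field_simp; ring
      have e2 : c * q ^ (#S + 1) / b / (c * q ^ (2 * (#S + 1)) * x o) =
          1 / (b * q ^ (#S + 1) * x o) := by field_simp; ring
      have e3 : c * q ^ (#S + 1) / (a * q) / x o = c * q ^ #S / a / x o := by field_simp; ring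
      have e4 : T S = subsetWeight θ q x a (b * q ^ (M + 1)) (c * q ^ (#S + 1) / (a * q))
          (c * q ^ #S / b) S (X \ S) := by
        rw [show c * q ^ #S / b = c * q * q ^ #S / (b * q) by field_simp,
          show b * q ^ (M + 1) = b * q * q ^ M by ring,
          show c * q ^ (#S + 1) = c * q * q ^ #S by ring]
      have e5 : ∑ l ∈ X \ S, F (#S + 1) S l ((X \ S).erase l) = K (#S + 1) * ∑ l ∈ X \ S,
          exchangeTerm θ q x o a (b * q ^ (M + 1)) (c * q ^ (#S + 1) / (a * q))
            (c * q ^ (#S + 1) / b) (c * q ^ (2 * (#S + 1))) S l ((X \ S).erase l) := by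
        rw [mul_sum]
      rw [e0, e1, e2, e3, ← e4] at hL
      rw [e5, card_insert_of_notMem hoS, insert_sdiff_insert, sdiff_insert_of_notMem ho,
        mul_assoc (K _), ← mul_add, ← hL, ← mul_assoc]
      congr 1
      exact (div_mul_cancel₀ _ (hnz' _)).symm
    -- The exchange terms cancel in pairs here; what is left is a multiple of T S for each S, to
    -- which the coefficient recurrence and then the induction hypothesis at (bq, cq) apply.
    rw [sum_congr rfl h1, sum_congr rfl h2, sum_sub_distrib, sum_add_distrib,
      sum_powerset_exchange X F]
    have h3 : ∀ S ∈ X.powerset,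
        K #S * (-(a * q * x o) * θ (1 / (c * q ^ #S)) * θ (1 / (q ^ #S * q * a * x o)) *
          θ (x o / (c * q ^ #S / b))) * T S +
        K (#S + 1) * (-(b * q ^ (M + 1) * x o ^ 2) * θ (c * q ^ #S / a / x o) *
          θ (1 / (c * q ^ (M + #S + 2))) * θ (1 / (b * q ^ (#S + 1) * x o))) * T S =
        θ (b / a) * (θ (a * x o * q / ρ₁) * θ (a * x o * q / ρ₂)) *
          (subsetCoeff θ q (b * q) (c * q) ρ₁ ρ₂ M #S * T S) := by
      intro S hS
      rw [← add_mul, hθ.subsetCoeff_recurrence hq ha hb hc hρ₁ hρ₂ (hx o) h hnz M #S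
        (card_le_card (mem_powerset.mp hS)), mul_assoc]
    have h4 := sum_congr rfl h3
    rw [sum_add_distrib, ← mul_sum, IH] at h4
    linear_combination h4

end IsThetaFun

/-! ### Strings of lattice points and their initial segments -/

/-- The set of lattice points `(r, i)` with `j r ≤ i < k r`. -/
def stringSet {n : ℕ} (j k : Fin n → ℕ) : Finset ((_ : Fin n) × ℕ) :=
  univ.sigma fun r => Ico (j r) (k r)

theorem mem_stringSet {n : ℕ} {j k : Fin n → ℕ} {r : Fin n} {i : ℕ} :
    (⟨r, i⟩ : (_ : Fin n) × ℕ) ∈ stringSet j k ↔ j r ≤ i ∧ i < k r := by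
  simp [stringSet]

theorem stringSet_sdiff {n : ℕ} {j k N : Fin n → ℕ} (hjk : j ≤ k) :
    stringSet j N \ stringSet j k = stringSet k N := by
  ext ⟨r, i⟩
  have : j r ≤ k r := hjk r
  simp only [mem_sdiff, mem_stringSet]
  omega

theorem prod_stringSet {n : ℕ} (j k : Fin n → ℕ) (f : (_ : Fin n) × ℕ → ℂ) :
    ∏ i ∈ stringSet j k, f i = ∏ r, ∏ i ∈ Ico (j r) (k r), f ⟨r, i⟩ := by
  rw [stringSet, prod_sigma]

theorem card_stringSet {n : ℕ} {j k : Fin n → ℕ} (hjk : j ≤ k) :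
    #(stringSet j k) = ∑ r, k r - ∑ r, j r := by
  rw [stringSet, card_sigma, ← sum_tsub_distrib _ fun r _ => hjk r]
  simp

/-- A sum over subsets of a union of strings that is supported on the unions of initial segments. -/
theorem sum_powerset_stringSet {n : ℕ} {j N : Fin n → ℕ} (hjN : j ≤ N)
    (f : Finset ((_ : Fin n) × ℕ) → ℂ)
    (hf : ∀ S ⊆ stringSet j N, ∀ r i, j r ≤ i → ⟨r, i + 1⟩ ∈ S → ⟨r, i⟩ ∉ S → f S = 0) :
    ∑ S ∈ (stringSet j N).powerset, f S = ∑ k ∈ Icc j N, f (stringSet j k) := by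
  symm
  refine sum_of_injOn (stringSet j) ?_ ?_ ?_ fun k _ => rfl
  · intro k hk l hl h
    have hk := (mem_Icc.mp (mem_coe.mp hk)).1
    have hl := (mem_Icc.mp (mem_coe.mp hl)).1
    funext r
    have h1 : j r ≤ k r := hk r
    have h2 : j r ≤ l r := hl r
    have h3 : ∀ i, j r ≤ i ∧ i < k r ↔ j r ≤ i ∧ i < l r := fun i => by
      rw [← mem_stringSet, h, mem_stringSet]
    have h4 := h3 (k r)
    have h5 := h3 (l r)
    omega
  · intro k hk
    have hk := (mem_Icc.mp (mem_coe.mp hk)).2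
    rw [mem_coe, mem_powerset]
    rintro ⟨r, i⟩ hi
    have : k r ≤ N r := hk r
    rw [mem_stringSet] at hi ⊢
    omega
  · intro S hS hS'
    have hS := mem_powerset.mp hS
    by_contra hne
    have hcl : ∀ r i, j r ≤ i → ⟨r, i + 1⟩ ∈ S → ⟨r, i⟩ ∈ S := fun r i hi h1 => by
      by_contra h2
      exact hne (hf S hS r i hi h1 h2)
    have hex : ∀ r, ∃ i, j r ≤ i ∧ ⟨r, i⟩ ∉ S := fun r =>
      ⟨N r, hjN r, fun h => by
        have := mem_stringSet.mp (hS h)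
        omega⟩
    classical
    -- The first index of the string r missing from S. If f S ≠ 0, then S is closed under
    -- predecessors within a string, so S contains nothing beyond it.
    let k : Fin n → ℕ := fun r => Nat.find (hex r)
    have hup : ∀ r d, (⟨r, k r + d⟩ : (_ : Fin n) × ℕ) ∉ S := fun r d => by
      induction d with
      | zero => exact (Nat.find_spec (hex r)).2
      | succ d ih =>
        intro h
        exact ih (hcl r _ ((Nat.find_spec (hex r)).1.trans (Nat.le_add_right _ _)) h)
    refine hS' ⟨k, ?_, ?_⟩
    · rw [mem_coe, mem_Icc]
      refine ⟨fun r => (Nat.find_spec (hex r)).1, fun r => Nat.find_min' (hex r) ⟨hjN r, fun h => ?_⟩⟩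
      have := mem_stringSet.mp (hS h)
      omega
    · ext ⟨r, i⟩
      rw [mem_stringSet]
      constructor
      · rintro ⟨h1, h2⟩
        have := Nat.find_min (hex r) h2
        by_contra h3
        exact this ⟨h1, h3⟩
      · intro h
        refine ⟨(mem_stringSet.mp (hS h)).1, ?_⟩
        by_contra h2
        obtain ⟨d, rfl⟩ := Nat.exists_eq_add_of_le (not_lt.mp h2)
        exact hup r d h

theorem prod_Ico_div_succ_mul (f : ℕ → ℂ) {j k : ℕ} (hjk : j ≤ k)
    (hf : ∀ i, j ≤ i → i < k → f (i + 1) ≠ 0) :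
    (∏ i ∈ Ico j k, f i / f (i + 1)) * f k = f j := by
  induction k, hjk using Nat.le_induction with
  | base => simp
  | succ k hjk ih =>
    rw [prod_Ico_succ_top hjk, mul_assoc, div_mul_cancel₀ _ (hf k hjk (Nat.lt_succ_self k))]
    exact ih fun i hi hik => hf i hi (hik.trans (Nat.lt_succ_self k))

/-! ### Theta products along strings -/

theorem ellFac_natCast (p q z : ℂ) (k : ℕ) :
    ellFac p q z (k : ℤ) = shiftedFac (ellTheta p) q z k := rfl

theorem ellFac_sub (p q z : ℂ) {j k : ℕ} (hjk : j ≤ k) :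
    ellFac p q z ((k : ℤ) - j) = shiftedFac (ellTheta p) q z (k - j) := by
  rw [← Nat.cast_sub hjk, ellFac_natCast]

theorem shiftedFac_mul_pow (θ : ℂ → ℂ) (q z : ℂ) {j k : ℕ} :
    shiftedFac θ q (z * q ^ j) (k - j) = ∏ i ∈ Ico j k, θ (z * q ^ i) := by
  rw [shiftedFac, prod_Ico_eq_prod_range]
  exact prod_congr rfl fun i _ => by rw [pow_add, mul_assoc]

theorem shiftedFac_mul_prod_Ico (θ : ℂ → ℂ) (q z : ℂ) {j k : ℕ} (hjk : j ≤ k) :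
    shiftedFac θ q z j * ∏ i ∈ Ico j k, θ (z * q ^ i) = shiftedFac θ q z k :=
  prod_range_mul_prod_Ico _ hjk

theorem shiftedFac_reflect (θ : ℂ → ℂ) {q : ℂ} (hq : q ≠ 0) (z : ℂ) {j k : ℕ} (hjk : j ≤ k) :
    shiftedFac θ q (z / q ^ k) (k - j) = ∏ i ∈ Ico j k, θ (z / (q * q ^ i)) := by
  rw [shiftedFac, prod_Ico_eq_prod_range, ← prod_range_reflect]
  refine prod_congr rfl fun i hi => ?_
  have hi := mem_range.mp hi
  congr 1
  rw [show q ^ k = q * q ^ (j + i) * q ^ (k - j - 1 - i) by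
    rw [← pow_succ', ← pow_add]; congr 1; omega]
  field_simp

/-- The roles of r and s are interchanged so that the range of l depends on one string only while
the lower end of the other enters as an exponent; in this form denominators for adjacent ranges can
be merged. -/
theorem ellDen_eq_prod {n : ℕ} (p : ℂ) {q : ℂ} (hq : q ≠ 0) (x : Fin n → ℂ) {j k : Fin n → ℕ}
    (hjk : j ≤ k) : ellDen p q x k j =
      ∏ r, ∏ s, ∏ l ∈ Ico (j s) (k s),
        ellTheta p (x s / x r * q ^ ((l : ℤ) + 1 - (j r : ℤ))) := by
  rw [ellDen, prod_comm]
  refine prod_congr rfl fun r _ => prod_congr rfl fun s _ => ?_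
  rw [ellFac_sub p q _ (hjk s)]
  have : q ^ (1 + (j s : ℤ) - (j r : ℤ)) * x s / x r =
      (x s / x r * q ^ (1 - (j r : ℤ))) * q ^ j s := by
    rw [add_sub_right_comm, zpow_add₀ hq, zpow_natCast]
    ring
  rw [this, shiftedFac_mul_pow]
  refine prod_congr rfl fun l _ => ?_
  rw [mul_assoc, ← zpow_natCast q l, ← zpow_add₀ hq]
  congr 3
  ring

theorem ellTheta_string_ne_zero {n : ℕ} {p q : ℂ} (hp : ‖p‖ < 1) (hq : q ≠ 0) {x : Fin n → ℂ}
    (hx : ∀ r, x r ≠ 0) (hqq : ∀ m : ℕ, ellTheta p (q ^ (m + 1)) ≠ 0)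
    (hxx : ∀ r s : Fin n, r ≠ s → ∀ m : ℤ, ellTheta p (q ^ m * x r / x s) ≠ 0)
    (r s : Fin n) (m : ℤ) (h : r ≠ s ∨ m ≠ 0) : ellTheta p (x r / x s * q ^ m) ≠ 0 := by
  by_cases hrs : r = s
  · subst hrs
    have hm : m ≠ 0 := h.resolve_left fun h => h rfl
    rw [div_self (hx r), one_mul]
    rcases lt_trichotomy m 0 with hm' | hm' | hm'
    · obtain ⟨d, rfl⟩ : ∃ d : ℕ, m = -((d + 1 : ℕ) : ℤ) := ⟨(-m - 1).toNat, by omega⟩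
      rw [zpow_neg, zpow_natCast, (isThetaFun_ellTheta hp).inv _ (pow_ne_zero _ hq)]
      exact mul_ne_zero (neg_ne_zero.mpr (inv_ne_zero (pow_ne_zero _ hq))) (hqq d)
    · exact absurd hm' hm
    · obtain ⟨d, rfl⟩ : ∃ d : ℕ, m = ((d + 1 : ℕ) : ℤ) := ⟨(m - 1).toNat, by omega⟩
      rw [zpow_natCast]
      exact hqq d
  · have := hxx r s hrs m
    rwa [mul_div_assoc, mul_comm] at this

/-- The points `x_r q ^ i`. -/
noncomputable def stringPoint {n : ℕ} (q : ℂ) (x : Fin n → ℂ) (i : (_ : Fin n) × ℕ) : ℂ :=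
  x i.1 * q ^ i.2

/-- For a fixed point l of the string s beyond k s, the interaction with the points i of the string
r, j r ≤ i < k r, telescopes: each factor is f(i)/f(i+1) with f(i) = θ(x_s/x_r · q^{l+1-i}). Hence
it replaces f(k r) by f(j r), and the ranges [j s, k s) and [k s, N s) join. -/
theorem crossProd_stringSet_mul_ellDen {n : ℕ} {p q : ℂ} (hp : ‖p‖ < 1) (hq : q ≠ 0)
    {x : Fin n → ℂ} (hx : ∀ r, x r ≠ 0) (hqq : ∀ m : ℕ, ellTheta p (q ^ (m + 1)) ≠ 0)
    (hxx : ∀ r s : Fin n, r ≠ s → ∀ m : ℤ, ellTheta p (q ^ m * x r / x s) ≠ 0)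
    {j k N : Fin n → ℕ} (hjk : j ≤ k) (hkN : k ≤ N) :
    crossProd (ellTheta p) q (stringPoint q x) (stringSet j k) (stringSet k N) *
      (ellDen p q x k j * ellDen p q x N k) = ellDen p q x N j := by
  rw [ellDen_eq_prod p hq x hjk, ellDen_eq_prod p hq x hkN, ellDen_eq_prod p hq x (hjk.trans hkN),
    crossProd, prod_stringSet]
  simp_rw [prod_stringSet]
  rw [← prod_mul_distrib, ← prod_mul_distrib]
  refine prod_congr rfl fun r _ => ?_
  rw [prod_comm, ← prod_mul_distrib, ← prod_mul_distrib]
  refine prod_congr rfl fun s _ => ?_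
  rw [prod_comm, mul_left_comm, ← prod_mul_distrib, ← prod_Ico_consecutive _ (hjk s) (hkN s)]
  congr 1
  refine prod_congr rfl fun l hl => ?_
  have hl := (mem_Ico.mp hl).1
  rw [← prod_Ico_div_succ_mul (fun i : ℕ => ellTheta p (x s / x r * q ^ ((l : ℤ) + 1 - (i : ℤ))))
    (hjk r)]
  · congr 1
    refine prod_congr rfl fun i _ => ?_
    have h1 := hx r
    have h2 := hx s
    have e1 : q * stringPoint q x ⟨s, l⟩ / stringPoint q x ⟨r, i⟩ =
        x s / x r * q ^ ((l : ℤ) + 1 - (i : ℤ)) := by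
      rw [zpow_sub₀ hq, zpow_add_one₀ hq, zpow_natCast, zpow_natCast, stringPoint, stringPoint]
      field_simp
    have e2 : stringPoint q x ⟨s, l⟩ / stringPoint q x ⟨r, i⟩ =
        x s / x r * q ^ ((l : ℤ) + 1 - ((i + 1 : ℕ) : ℤ)) := by
      rw [show (l : ℤ) + 1 - ((i + 1 : ℕ) : ℤ) = l - i by push_cast; ring, zpow_sub₀ hq,
        zpow_natCast, zpow_natCast, stringPoint, stringPoint]
      field_simp
    rw [e1, e2]
  · intro i _ hi
    refine ellTheta_string_ne_zero hp hq hx hqq hxx s r _ ?_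
    by_cases h : s = r
    · subst h
      -- On a single string l ≥ k r > i, so the exponent l - i is positive and θ(1) does not occur
      -- in a denominator.
      right
      push_cast
      omega
    · exact Or.inl h

theorem ellDen_ne_zero {n : ℕ} {p q : ℂ} (hp : ‖p‖ < 1) (hq : q ≠ 0)
    {x : Fin n → ℂ} (hx : ∀ r, x r ≠ 0) (hqq : ∀ m : ℕ, ellTheta p (q ^ (m + 1)) ≠ 0)
    (hxx : ∀ r s : Fin n, r ≠ s → ∀ m : ℤ, ellTheta p (q ^ m * x r / x s) ≠ 0)
    {j k : Fin n → ℕ} (hjk : j ≤ k) : ellDen p q x k j ≠ 0 := by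
  rw [ellDen_eq_prod p hq x hjk]
  refine prod_ne_zero_iff.mpr fun r _ => prod_ne_zero_iff.mpr fun s _ =>
    prod_ne_zero_iff.mpr fun l hl => ellTheta_string_ne_zero hp hq hx hqq hxx s r _ ?_
  have hl := (mem_Ico.mp hl).1
  by_cases h : s = r
  · subst h
    right
    omega
  · exact Or.inl h

theorem vsum_eq_natCast {n : ℕ} (k : Fin n → ℕ) : vsum k = ((∑ r, k r : ℕ) : ℤ) := by
  rw [vsum]; push_cast; rfl

theorem two_mul_vpairs {n : ℕ} (k : Fin n → ℕ) :
    2 * vpairs k = (∑ r, (k r : ℤ)) ^ 2 - ∑ r, (k r : ℤ) ^ 2 := by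
  have h1 : ∀ s : Fin n, ∑ r, (k r : ℤ) * (k s : ℤ) = ∑ r ∈ Iio s, (k r : ℤ) * (k s : ℤ) +
      ((k s : ℤ) ^ 2 + ∑ r ∈ Ioi s, (k r : ℤ) * (k s : ℤ)) := fun s => by
    have e : (univ : Finset (Fin n)) = Iio s ∪ insert s (Ioi s) := by
      ext r
      simp only [mem_univ, mem_union, mem_Iio, mem_insert, mem_Ioi, true_iff]
      rcases lt_trichotomy r s with h | h | h <;> tauto
    rw [e, sum_union, sum_insert (by simp), sq]
    rw [disjoint_left]
    intro r hr hr'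
    simp only [mem_Iio, mem_insert, mem_Ioi] at hr hr'
    rcases hr' with h | h
    · exact hr.ne h
    · exact lt_asymm hr h
  have h2 : ∑ s, ∑ r ∈ Ioi s, (k r : ℤ) * (k s : ℤ) = vpairs k := by
    rw [vpairs, sum_comm' (t' := univ) (s' := fun r => Iio r)]
    · exact sum_congr rfl fun s _ => sum_congr rfl fun r _ => mul_comm _ _
    · simp
  have h3 : (∑ r, (k r : ℤ)) ^ 2 = ∑ s, ∑ r, (k r : ℤ) * (k s : ℤ) := by
    rw [sq, sum_mul_sum, sum_comm]
  rw [h3, sum_congr rfl fun s _ => h1 s, sum_add_distrib, sum_add_distrib, h2, vpairs]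
  ring

theorem two_mul_choose_two (m : ℕ) : 2 * ((m.choose 2 : ℕ) : ℤ) = m * (m - 1) := by
  induction m with
  | zero => simp
  | succ m ih =>
    rw [Nat.choose_succ_succ' m 1, Nat.choose_one_right]
    push_cast
    linear_combination ih

theorem two_mul_sum_Ico {j k : ℕ} (hjk : j ≤ k) :
    2 * ((∑ i ∈ Ico j k, i : ℕ) : ℤ) = k * (k - 1) - j * (j - 1) := by
  induction k, hjk using Nat.le_induction with
  | base => simp
  | succ k hjk ih =>
    rw [sum_Ico_succ_top hjk]
    push_cast at ih ⊢
    linear_combination ih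

theorem prod_stringPoint {n : ℕ} (q : ℂ) (x : Fin n → ℂ) (j k : Fin n → ℕ) :
    ∏ i ∈ stringSet j k, stringPoint q x i =
      (∏ r, x r ^ (k r - j r)) * q ^ ∑ r, ∑ i ∈ Ico (j r) (k r), i := by
  rw [prod_stringSet, ← prod_pow_eq_pow_sum, ← prod_mul_distrib]
  refine prod_congr rfl fun r _ => ?_
  simp_rw [stringPoint]
  rw [prod_mul_distrib, prod_const, Nat.card_Ico, prod_pow_eq_pow_sum]

/-- The powers of `q` and `x_r` in the multivariate sum agree with those in the subset form. -/
theorem pow_vpairs_eq {n : ℕ} {q : ℂ} (hq : q ≠ 0) (u : ℂ) (x : Fin n → ℂ)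
    {j k : Fin n → ℕ} (hjk : j ≤ k) :
    (u / q ^ ∑ r, j r) ^ (∑ r, k r - ∑ r, j r) / q ^ (∑ r, k r - ∑ r, j r).choose 2 *
      ((∏ r, x r ^ (k r - j r)) * q ^ ∑ r, ∑ i ∈ Ico (j r) (k r), i) *
      (u ^ (∑ r, j r) * (∏ r, x r ^ j r) * q ^ (-vpairs j)) =
    u ^ (∑ r, k r) * (∏ r, x r ^ k r) * q ^ (-vpairs k) := by
  have hle : ∑ r, j r ≤ ∑ r, k r := sum_le_sum fun r _ => hjk r
  have hx : ∏ r, x r ^ k r = (∏ r, x r ^ (k r - j r)) * ∏ r, x r ^ j r := by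
    rw [← prod_mul_distrib]
    exact prod_congr rfl fun r _ => by rw [← pow_add, Nat.sub_add_cancel (hjk r)]
  obtain ⟨m, hm⟩ := Nat.exists_eq_add_of_le hle
  -- The comparison of the exponents of q, with m = |k| - |j|. It is checked after doubling, where
  -- binomials and sums of indices become polynomials.
  have hkey : -((∑ r, j r * m : ℕ) : ℤ) - ((m.choose 2 : ℕ) : ℤ) +
      ((∑ r, ∑ i ∈ Ico (j r) (k r), i : ℕ) : ℤ) - vpairs j = -vpairs k := by
    have h1 := two_mul_vpairs j
    have h2 := two_mul_vpairs k
    have h3 := two_mul_choose_two m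
    have h4 : 2 * ((∑ r, ∑ i ∈ Ico (j r) (k r), i : ℕ) : ℤ) =
        ∑ r, ((k r : ℤ) ^ 2 - k r - (j r : ℤ) ^ 2 + j r) := by
      rw [Nat.cast_sum, mul_sum]
      refine sum_congr rfl fun r _ => ?_
      rw [two_mul_sum_Ico (hjk r)]
      ring
    rw [sum_add_distrib, sum_sub_distrib, sum_sub_distrib] at h4
    have h5 : (∑ r, (k r : ℤ)) = ∑ r, (j r : ℤ) + m := by exact_mod_cast hm
    have h6 : ((∑ r, j r * m : ℕ) : ℤ) = (∑ r, (j r : ℤ)) * m := by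
      push_cast
      rw [sum_mul]
    rw [h6]
    rw [h5] at h2 h4
    have : (2 : ℤ) ≠ 0 := two_ne_zero
    refine mul_left_cancel₀ this ?_
    linear_combination -h3 + h4 - h1 + h2
  rw [hx, hm, Nat.add_sub_cancel_left, ← hkey, zpow_sub₀ hq, zpow_add₀ hq, zpow_sub₀ hq, zpow_neg,
    zpow_neg, zpow_natCast, zpow_natCast, zpow_natCast, ← sum_mul, pow_mul, pow_add]
  generalize q ^ ∑ r, j r = v
  rw [div_pow]
  ring

theorem shiftedFac_ne_zero {θ : ℂ → ℂ} {q z : ℂ} (h : ∀ m : ℕ, θ (z * q ^ m) ≠ 0) (k : ℕ) :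
    shiftedFac θ q z k ≠ 0 :=
  prod_ne_zero_iff.mpr fun m _ => h m

theorem shiftedFac_mul_shiftedFac (θ : ℂ → ℂ) (q z : ℂ) {j k : ℕ} (hjk : j ≤ k) :
    shiftedFac θ q z j * shiftedFac θ q (z * q ^ j) (k - j) = shiftedFac θ q z k := by
  rw [shiftedFac_mul_pow, shiftedFac_mul_prod_Ico _ _ _ hjk]

/-- Here A, K, L stand for |j|, |k|, |N|. The prefactor supplies the first A factors of (ρ)_K, while
the tails in the coefficient cancel against (cq/ρ)_L and leave (cq/ρ)_K, so all shifted factorials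
get their original base points back. -/
theorem subsetCoeff_shift {θ : ℂ → ℂ} {q b c ρ₁ ρ₂ : ℂ} (hq : q ≠ 0)
    (hc : c ≠ 0) (hρ₁ : ρ₁ ≠ 0) (hρ₂ : ρ₂ ≠ 0)
    (hnz : ∀ m : ℕ, θ (c * q ^ m) ≠ 0) (hnz₁ : ∀ m : ℕ, θ (c * q / ρ₁ * q ^ m) ≠ 0)
    (hnz₂ : ∀ m : ℕ, θ (c * q / ρ₂ * q ^ m) ≠ 0) {A K L : ℕ} (hAK : A ≤ K) (hKL : K ≤ L) :
    shiftedFac θ q ρ₁ A * shiftedFac θ q ρ₂ A /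
        (shiftedFac θ q (c * q / ρ₁) L * shiftedFac θ q (c * q / ρ₂) L) *
      subsetCoeff θ q (b * q ^ A) (c * q ^ (2 * A)) (ρ₁ * q ^ A) (ρ₂ * q ^ A) (L - A) (K - A) =
    shiftedFac θ q ρ₁ K * shiftedFac θ q ρ₂ K /
        (shiftedFac θ q (c * q / ρ₁) K * shiftedFac θ q (c * q / ρ₂) K) *
      (θ (c * q ^ (2 * K)) * shiftedFac θ q c (K + A) / shiftedFac θ q c (L + K + 1)) *
      ((b / c / q ^ A) ^ (K - A) / q ^ (K - A).choose 2) := by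
  obtain ⟨m, rfl⟩ := Nat.exists_eq_add_of_le hAK
  obtain ⟨d, rfl⟩ := Nat.exists_eq_add_of_le hKL
  have s1 : ∀ ρ, shiftedFac θ q ρ (A + m) = shiftedFac θ q ρ A * shiftedFac θ q (ρ * q ^ A) m :=
    fun ρ => by rw [← shiftedFac_mul_shiftedFac θ q ρ (Nat.le_add_right A m), Nat.add_sub_cancel_left]
  have s2 : ∀ ρ, shiftedFac θ q (c * q / ρ) (A + m + d) = shiftedFac θ q (c * q / ρ) (A + m) *
      shiftedFac θ q (c * q / ρ * q ^ (A + m)) d := fun ρ => by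
    rw [← shiftedFac_mul_shiftedFac θ q _ (Nat.le_add_right (A + m) d), Nat.add_sub_cancel_left]
  have s3 : shiftedFac θ q c (A + m + d + (A + m) + 1) = shiftedFac θ q c (A + m + A) *
      shiftedFac θ q (c * q ^ (A + m + A)) (m + d + 1) := by
    rw [← shiftedFac_mul_shiftedFac θ q c (show A + m + A ≤ A + m + d + (A + m) + 1 by omega)]
    congr 2
    omega
  have n1 := shiftedFac_ne_zero hnz (A + m + A)
  have n2 := shiftedFac_ne_zero hnz (A + m + d + (A + m) + 1)
  have n3 := shiftedFac_ne_zero hnz₁ (A + m + d)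
  have n4 := shiftedFac_ne_zero hnz₂ (A + m + d)
  rw [s3] at n2
  rw [s2] at n3 n4
  rw [subsetCoeff, s1 ρ₁, s1 ρ₂, s2 ρ₁, s2 ρ₂, s3, Nat.add_sub_cancel_left,
    show A + m + d - A = m + d by omega, Nat.add_sub_cancel_left,
    show c * q ^ (2 * A) * q ^ (2 * m) = c * q ^ (2 * (A + m)) by ring,
    show c * q ^ (2 * A) * q ^ m = c * q ^ (A + m + A) by ring,
    show c * q ^ (2 * A) * q ^ (m + 1) / (ρ₁ * q ^ A) = c * q / ρ₁ * q ^ (A + m) by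
      field_simp; ring,
    show c * q ^ (2 * A) * q ^ (m + 1) / (ρ₂ * q ^ A) = c * q / ρ₂ * q ^ (A + m) by
      field_simp; ring,
    show b * q ^ A / (c * q ^ (2 * A)) = b / c / q ^ A by field_simp; ring]
  have n5 := right_ne_zero_of_mul n2
  have n6 := right_ne_zero_of_mul n3
  have n7 := right_ne_zero_of_mul n4
  have n8 := left_ne_zero_of_mul n3
  have n9 := left_ne_zero_of_mul n4
  generalize (b / c / q ^ A) ^ m / q ^ m.choose 2 = w
  generalize shiftedFac θ q (c * q / ρ₁) (A + m) = t₁ at *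
  generalize shiftedFac θ q (c * q / ρ₂) (A + m) = t₂ at *
  generalize shiftedFac θ q (c * q / ρ₁ * q ^ (A + m)) d = t₃ at *
  generalize shiftedFac θ q (c * q / ρ₂ * q ^ (A + m)) d = t₄ at *
  generalize shiftedFac θ q c (A + m + A) = t₅ at *
  generalize shiftedFac θ q (c * q ^ (A + m + A)) (m + d + 1) = t₆ at *
  field_simp

/-- Each product over a string extends or truncates a shifted factorial, and the interaction
supplies the ratio of the three double products. What comes out is the part of the Jackson summand
built from products over r, together with the monomial ∏ of the chosen points. -/
theorem subsetWeight_stringSet {n : ℕ} {p q : ℂ} (hp : ‖p‖ < 1) (hq : q ≠ 0)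
    {x : Fin n → ℂ} (hx : ∀ r, x r ≠ 0) (hqq : ∀ m : ℕ, ellTheta p (q ^ (m + 1)) ≠ 0)
    (hxx : ∀ r s : Fin n, r ≠ s → ∀ m : ℤ, ellTheta p (q ^ m * x r / x s) ≠ 0)
    {a b c : ℂ} (ha : a ≠ 0) (hb : b ≠ 0) (hc : c ≠ 0)
    (hax : ∀ (r : Fin n) (m : ℕ), ellTheta p (a * x r * q * q ^ m) ≠ 0)
    {j k N : Fin n → ℕ} (hjk : j ≤ k) (hkN : k ≤ N) {A K L : ℕ} (hAK : A ≤ K) (hAL : A ≤ L) :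
    (∏ r, shiftedFac (ellTheta p) q (b * x r) (L + j r)) /
        (ellDen p q x N j * ∏ r, shiftedFac (ellTheta p) q (a * x r * q) (N r + A)) *
      subsetWeight (ellTheta p) q (stringPoint q x) (a * q ^ A) (b * q ^ A * q ^ (L - A))
        (c * q ^ (2 * A) * q ^ (K - A) / (a * q ^ A * q)) (c * q ^ (2 * A) * q ^ (K - A) / (b * q ^ A))
        (stringSet j k) (stringSet k N) =
    ((∏ r, x r ^ (k r - j r)) * q ^ ∑ r, ∑ i ∈ Ico (j r) (k r), i) *
      ((∏ r, shiftedFac (ellTheta p) q (b * x r) (L + k r)) *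
        (∏ r, shiftedFac (ellTheta p) q (b * x r / (c * q ^ K) * q ^ k r) (N r - k r)) /
        ellDen p q x N k) *
      ((∏ r, shiftedFac (ellTheta p) q (c * q ^ K / (a * x r) / q ^ k r) (k r - j r)) /
        (ellDen p q x k j * ∏ r, shiftedFac (ellTheta p) q (a * x r * q) (k r + A))) := by
  have e1 : b * q ^ A * q ^ (L - A) = b * q ^ L := by
    rw [mul_assoc, ← pow_add, Nat.add_sub_cancel' hAL]
  have hK : q ^ K = q ^ A * q ^ (K - A) := by rw [← pow_add, Nat.add_sub_cancel' hAK]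
  have e2 : c * q ^ (2 * A) * q ^ (K - A) / (a * q ^ A * q) = c * q ^ K / (a * q) := by
    rw [hK]; field_simp; ring
  have e3 : c * q ^ (2 * A) * q ^ (K - A) / (b * q ^ A) = c * q ^ K / b := by
    rw [hK]; field_simp; ring
  rw [e1, e2, e3, subsetWeight, prod_mul_distrib, prod_mul_distrib, prod_mul_distrib,
    prod_stringPoint, prod_stringSet, prod_stringSet, prod_stringSet, prod_stringSet]
  have f1 : (∏ r, shiftedFac (ellTheta p) q (b * x r) (L + j r)) *
      ∏ r, ∏ i ∈ Ico (j r) (k r), ellTheta p (b * q ^ L * stringPoint q x ⟨r, i⟩) =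
      ∏ r, shiftedFac (ellTheta p) q (b * x r) (L + k r) := by
    rw [← prod_mul_distrib]
    refine prod_congr rfl fun r _ => ?_
    rw [← shiftedFac_mul_prod_Ico (ellTheta p) q (b * x r) (Nat.add_le_add_left (hjk r) L),
      add_comm L, add_comm L, ← prod_Ico_add']
    congr 1
    refine prod_congr rfl fun i _ => ?_
    rw [stringPoint]
    congr 1
    ring
  have f2 : ∏ r, ∏ i ∈ Ico (j r) (k r), ellTheta p (c * q ^ K / (a * q) / stringPoint q x ⟨r, i⟩) =
      ∏ r, shiftedFac (ellTheta p) q (c * q ^ K / (a * x r) / q ^ k r) (k r - j r) := by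
    refine prod_congr rfl fun r _ => ?_
    rw [shiftedFac_reflect _ hq _ (hjk r)]
    refine prod_congr rfl fun i _ => ?_
    rw [stringPoint]
    congr 1
    have := hx r
    field_simp
  have f3 : (∏ r, shiftedFac (ellTheta p) q (a * x r * q) (k r + A)) *
      ∏ r, ∏ i ∈ Ico (k r) (N r), ellTheta p (a * q ^ A * stringPoint q x ⟨r, i⟩ * q) =
      ∏ r, shiftedFac (ellTheta p) q (a * x r * q) (N r + A) := by
    rw [← prod_mul_distrib]
    refine prod_congr rfl fun r _ => ?_
    rw [← shiftedFac_mul_prod_Ico (ellTheta p) q (a * x r * q) (Nat.add_le_add_right (hkN r) A),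
      ← prod_Ico_add']
    congr 1
    refine prod_congr rfl fun i _ => ?_
    rw [stringPoint]
    congr 1
    ring
  have f4 : ∏ r, ∏ i ∈ Ico (k r) (N r), ellTheta p (stringPoint q x ⟨r, i⟩ / (c * q ^ K / b)) =
      ∏ r, shiftedFac (ellTheta p) q (b * x r / (c * q ^ K) * q ^ k r) (N r - k r) := by
    refine prod_congr rfl fun r _ => ?_
    rw [shiftedFac_mul_pow]
    refine prod_congr rfl fun i _ => ?_
    rw [stringPoint]
    congr 1
    field_simp
  have f5 := crossProd_stringSet_mul_ellDen hp hq hx hqq hxx hjk hkN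
  have n1 := ellDen_ne_zero hp hq hx hqq hxx hjk
  have n2 := ellDen_ne_zero hp hq hx hqq hxx hkN
  have n3 := ellDen_ne_zero hp hq hx hqq hxx (hjk.trans hkN)
  have n4 : ∏ r, shiftedFac (ellTheta p) q (a * x r * q) (k r + A) ≠ 0 :=
    prod_ne_zero_iff.mpr fun r _ => shiftedFac_ne_zero (hax r) _
  have n5 : ∏ r, shiftedFac (ellTheta p) q (a * x r * q) (N r + A) ≠ 0 :=
    prod_ne_zero_iff.mpr fun r _ => shiftedFac_ne_zero (hax r) _
  rw [f2, f4, ← f1, ← f5]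
  rw [← f5] at n3
  rw [← f3] at n5 ⊢
  have n6 := left_ne_zero_of_mul n3
  have n7 := right_ne_zero_of_mul n5
  generalize crossProd (ellTheta p) q (stringPoint q x) (stringSet j k) (stringSet k N) = t₁ at *
  generalize ellDen p q x k j = t₂ at *
  generalize ellDen p q x N k = t₃ at *
  generalize ∏ r, shiftedFac (ellTheta p) q (a * x r * q) (k r + A) = t₄ at *
  generalize ∏ r, ∏ i ∈ Ico (k r) (N r), ellTheta p (a * q ^ A * stringPoint q x ⟨r, i⟩ * q) = t₅ at *
  generalize ∏ r, shiftedFac (ellTheta p) q (b * x r / (c * q ^ K) * q ^ k r) (N r - k r) = t₆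
  generalize ∏ r, shiftedFac (ellTheta p) q (c * q ^ K / (a * x r) / q ^ k r) (k r - j r) = t₇
  generalize ∏ r, shiftedFac (ellTheta p) q (b * x r) (L + j r) = t₈
  generalize ∏ r, ∏ i ∈ Ico (j r) (k r), ellTheta p (b * q ^ L * stringPoint q x ⟨r, i⟩) = t₉
  generalize (∏ r, x r ^ (k r - j r)) * q ^ ∑ r, ∑ i ∈ Ico (j r) (k r), i = t₁₀
  clear * - n1 n2 n4 n6 n7
  field_simp

/-! ### The multivariate Jackson sum and the Bailey lemma -/

/-- The coefficient of `β_k` in `β'_N`, apart from the prefactor depending on `N` only. -/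
noncomputable def betaCoeff {n : ℕ} (p q : ℂ) (x : Fin n → ℂ) (ρ₁ ρ₂ a b : ℂ)
    (N k : Fin n → ℕ) : ℂ :=
  ellFac p q ρ₁ (vsum k) * ellFac p q ρ₂ (vsum k) /
      (ellFac p q (b * ρ₁ / a) (vsum k) * ellFac p q (b * ρ₂ / a) (vsum k)) *
    (ellTheta p (b * ρ₁ * ρ₂ * q ^ (2 * vsum k) / (a * q)) /
      ellTheta p (b * ρ₁ * ρ₂ / (a * q))) *
    ((∏ r, ellFac p q (b * x r) (vsum N + (k r : ℤ)) *
          ellFac p q (a * x r * q ^ (1 + (k r : ℤ) - vsum k) / (ρ₁ * ρ₂))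
            ((N r : ℤ) - (k r : ℤ))) /
      (ellFac p q (b * ρ₁ * ρ₂ / a) (vsum N + vsum k) * ellDen p q x N k)) *
    (a * q / (ρ₁ * ρ₂)) ^ vsum k * (∏ r, x r ^ k r) * q ^ (-vpairs k)

/-- The summand of the multivariate elliptic Jackson sum. -/
noncomputable def jacksonTerm {n : ℕ} (p q : ℂ) (x : Fin n → ℂ) (ρ₁ ρ₂ a b c : ℂ)
    (N j k : Fin n → ℕ) : ℂ :=
  shiftedFac (ellTheta p) q ρ₁ (∑ r, k r) * shiftedFac (ellTheta p) q ρ₂ (∑ r, k r) /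
      (shiftedFac (ellTheta p) q (c * q / ρ₁) (∑ r, k r) *
        shiftedFac (ellTheta p) q (c * q / ρ₂) (∑ r, k r)) *
    (ellTheta p (c * q ^ (2 * ∑ r, k r)) * shiftedFac (ellTheta p) q c (∑ r, k r + ∑ r, j r) /
      shiftedFac (ellTheta p) q c (∑ r, N r + ∑ r, k r + 1)) *
    ((∏ r, shiftedFac (ellTheta p) q (b * x r) (∑ r, N r + k r)) *
      (∏ r, shiftedFac (ellTheta p) q (b * x r / (c * q ^ ∑ r, k r) * q ^ k r) (N r - k r)) /
        ellDen p q x N k) *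
    ((∏ r, shiftedFac (ellTheta p) q (c * q ^ (∑ r, k r) / (a * x r) / q ^ k r) (k r - j r)) /
      (ellDen p q x k j * ∏ r, shiftedFac (ellTheta p) q (a * x r * q) (k r + ∑ r, j r))) *
    ((b / c) ^ (∑ r, k r) * (∏ r, x r ^ k r) * q ^ (-vpairs k))

/-- The multivariate elliptic Jackson summation. -/
theorem sum_jacksonTerm {n : ℕ} {p q : ℂ} (hp : ‖p‖ < 1) (hq : q ≠ 0)
    {x : Fin n → ℂ} (hx : ∀ r, x r ≠ 0) {a b c ρ₁ ρ₂ : ℂ} (ha : a ≠ 0) (hb : b ≠ 0) (hc : c ≠ 0)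
    (hρ₁ : ρ₁ ≠ 0) (hρ₂ : ρ₂ ≠ 0) (h : ρ₁ * ρ₂ * b = c * q * a)
    (hqq : ∀ m : ℕ, ellTheta p (q ^ (m + 1)) ≠ 0)
    (hxx : ∀ r s : Fin n, r ≠ s → ∀ m : ℤ, ellTheta p (q ^ m * x r / x s) ≠ 0)
    (hax : ∀ (r : Fin n) (m : ℕ), ellTheta p (a * x r * q * q ^ m) ≠ 0)
    (hnz : ∀ m : ℕ, ellTheta p (c * q ^ m) ≠ 0)
    (hnz₁ : ∀ m : ℕ, ellTheta p (c * q / ρ₁ * q ^ m) ≠ 0)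
    (hnz₂ : ∀ m : ℕ, ellTheta p (c * q / ρ₂ * q ^ m) ≠ 0)
    {j N : Fin n → ℕ} (hjN : j ≤ N) :
    (∏ r, shiftedFac (ellTheta p) q (a * x r * q / ρ₁) (j r) *
        shiftedFac (ellTheta p) q (a * x r * q / ρ₂) (j r)) *
      ∑ k ∈ Icc j N, jacksonTerm p q x ρ₁ ρ₂ a b c N j k =
    shiftedFac (ellTheta p) q ρ₁ (∑ r, j r) * shiftedFac (ellTheta p) q ρ₂ (∑ r, j r) /
        (shiftedFac (ellTheta p) q (c * q / ρ₁) (∑ r, N r) *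
          shiftedFac (ellTheta p) q (c * q / ρ₂) (∑ r, N r)) *
      ((∏ r, shiftedFac (ellTheta p) q (b * x r) (∑ r, N r + j r)) /
        (ellDen p q x N j * ∏ r, shiftedFac (ellTheta p) q (a * x r * q) (N r + ∑ r, j r))) *
      ((b / c) ^ (∑ r, j r) * (∏ r, x r ^ j r) * q ^ (-vpairs j)) *
      (shiftedFac (ellTheta p) q (b / a) (∑ r, N r - ∑ r, j r) *
        ∏ r, shiftedFac (ellTheta p) q (a * x r * q / ρ₁) (N r) *
          shiftedFac (ellTheta p) q (a * x r * q / ρ₂) (N r)) := by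
  have hθ := isThetaFun_ellTheta hp
  have hpt : ∀ i, stringPoint q x i ≠ 0 := fun i => mul_ne_zero (hx _) (pow_ne_zero _ hq)
  have hd : ∀ i l, i ≠ l → ellTheta p (stringPoint q x i / stringPoint q x l) ≠ 0 := by
    rintro ⟨r, i⟩ ⟨s, l⟩ hne
    have e : stringPoint q x ⟨r, i⟩ / stringPoint q x ⟨s, l⟩ = x r / x s * q ^ ((i : ℤ) - l) := by
      have := hx s
      rw [stringPoint, stringPoint, zpow_sub₀ hq, zpow_natCast, zpow_natCast]
      field_simp
    rw [e]
    refine ellTheta_string_ne_zero hp hq hx hqq hxx r s _ ?_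
    by_cases hrs : r = s
    · subst hrs
      right
      intro hil
      apply hne
      congr 1
      omega
    · exact Or.inl hrs
  set A := ∑ r, j r
  set L := ∑ r, N r
  have hAL : A ≤ L := sum_le_sum fun r _ => hjN r
  -- The summand couples k with |j|. Replacing a, b, ρ₁, ρ₂ by their multiples by q^A and c by c
  -- q^{2A}, with A = |j|, accounts for this, and both sides of the balancing condition are
  -- multiplied by q^{3A}.
  have key := hθ.sum_subsetCoeff_mul_subsetWeight (a := a * q ^ A) (ρ₁ := ρ₁ * q ^ A)
    (ρ₂ := ρ₂ * q ^ A) hq (by positivity) (by positivity) (by positivity) hpt hd (stringSet j N)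
    (b * q ^ A) (c * q ^ (2 * A)) (by positivity) (by positivity)
    (by linear_combination q ^ (3 * A) * h)
    (fun k => by rw [mul_assoc, ← pow_add]; exact hnz _)
  rw [sum_powerset_stringSet hjN] at key
  swap
  · intro S hS r i hi h1 h2
    have hmem : (⟨r, i⟩ : (_ : Fin n) × ℕ) ∈ stringSet j N \ S := by
      rw [mem_sdiff, mem_stringSet]
      have := (mem_stringSet.mp (hS h1)).2
      exact ⟨⟨hi, by omega⟩, h2⟩
    -- If S contains the point i + 1 of a string but not its predecessor i, this pair contributes
    -- θ(q · x_r q^i / (x_r q^{i+1})) = θ(1) = 0.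
    have hz : crossProd (ellTheta p) q (stringPoint q x) S (stringSet j N \ S) = 0 := by
      refine prod_eq_zero h1 (prod_eq_zero hmem ?_)
      have e : q * stringPoint q x ⟨r, i⟩ / stringPoint q x ⟨r, i + 1⟩ = 1 := by
        have := hx r
        rw [stringPoint, stringPoint]
        field_simp
        ring
      rw [e, hθ.one, zero_div]
    rw [subsetWeight, hz, mul_zero, mul_zero]
  have hprod : (∏ r, shiftedFac (ellTheta p) q (a * x r * q / ρ₁) (j r) *
        shiftedFac (ellTheta p) q (a * x r * q / ρ₂) (j r)) *
      ∏ i ∈ stringSet j N, ellTheta p (a * q ^ A * stringPoint q x i * q / (ρ₁ * q ^ A)) *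
        ellTheta p (a * q ^ A * stringPoint q x i * q / (ρ₂ * q ^ A)) =
      ∏ r, shiftedFac (ellTheta p) q (a * x r * q / ρ₁) (N r) *
          shiftedFac (ellTheta p) q (a * x r * q / ρ₂) (N r) := by
    rw [prod_stringSet, ← prod_mul_distrib]
    refine prod_congr rfl fun r _ => ?_
    rw [← shiftedFac_mul_prod_Ico _ _ (a * x r * q / ρ₁) (hjN r),
      ← shiftedFac_mul_prod_Ico _ _ (a * x r * q / ρ₂) (hjN r), prod_mul_distrib]
    have e : ∀ ρ, ρ ≠ 0 → ∏ i ∈ Ico (j r) (N r),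
        ellTheta p (a * q ^ A * stringPoint q x ⟨r, i⟩ * q / (ρ * q ^ A)) =
        ∏ i ∈ Ico (j r) (N r), ellTheta p (a * x r * q / ρ * q ^ i) := fun ρ hρ => by
      refine prod_congr rfl fun i _ => ?_
      rw [stringPoint]
      congr 1
      field_simp
    rw [e _ hρ₁, e _ hρ₂]
    ring
  have hterm : ∀ k ∈ Icc j N, jacksonTerm p q x ρ₁ ρ₂ a b c N j k =
      shiftedFac (ellTheta p) q ρ₁ A * shiftedFac (ellTheta p) q ρ₂ A /
        (shiftedFac (ellTheta p) q (c * q / ρ₁) L * shiftedFac (ellTheta p) q (c * q / ρ₂) L) *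
      ((∏ r, shiftedFac (ellTheta p) q (b * x r) (L + j r)) /
        (ellDen p q x N j * ∏ r, shiftedFac (ellTheta p) q (a * x r * q) (N r + A))) *
      ((b / c) ^ A * (∏ r, x r ^ j r) * q ^ (-vpairs j)) *
      (subsetCoeff (ellTheta p) q (b * q ^ A) (c * q ^ (2 * A)) (ρ₁ * q ^ A) (ρ₂ * q ^ A)
          #(stringSet j N) #(stringSet j k) *
        subsetWeight (ellTheta p) q (stringPoint q x) (a * q ^ A)
          (b * q ^ A * q ^ #(stringSet j N))
          (c * q ^ (2 * A) * q ^ #(stringSet j k) / (a * q ^ A * q))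
          (c * q ^ (2 * A) * q ^ #(stringSet j k) / (b * q ^ A)) (stringSet j k)
          (stringSet j N \ stringSet j k)) := by
    intro k hk
    obtain ⟨hjk, hkN⟩ := mem_Icc.mp hk
    have hAK : A ≤ ∑ r, k r := sum_le_sum fun r _ => hjk r
    have hKL : ∑ r, k r ≤ L := sum_le_sum fun r _ => hkN r
    rw [stringSet_sdiff hjk, card_stringSet hjk, card_stringSet hjN]
    have h1 := subsetCoeff_shift (b := b) hq hc hρ₁ hρ₂ hnz hnz₁ hnz₂ hAK hKL
    have h2 := subsetWeight_stringSet hp hq hx hqq hxx ha hb hc hax hjk hkN hAK hAL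
    have h3 := pow_vpairs_eq hq (b / c) x hjk
    calc _ = _ := by rw [jacksonTerm, ← h3]
      _ = (shiftedFac (ellTheta p) q ρ₁ (∑ r, k r) * shiftedFac (ellTheta p) q ρ₂ (∑ r, k r) /
            (shiftedFac (ellTheta p) q (c * q / ρ₁) (∑ r, k r) *
              shiftedFac (ellTheta p) q (c * q / ρ₂) (∑ r, k r)) *
            (ellTheta p (c * q ^ (2 * ∑ r, k r)) * shiftedFac (ellTheta p) q c (∑ r, k r + A) /
              shiftedFac (ellTheta p) q c (L + ∑ r, k r + 1)) *
            ((b / c / q ^ A) ^ (∑ r, k r - A) / q ^ (∑ r, k r - A).choose 2)) *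
          (((∏ r, x r ^ (k r - j r)) * q ^ ∑ r, ∑ i ∈ Ico (j r) (k r), i) *
            ((∏ r, shiftedFac (ellTheta p) q (b * x r) (L + k r)) *
              (∏ r, shiftedFac (ellTheta p) q (b * x r / (c * q ^ ∑ r, k r) * q ^ k r)
                (N r - k r)) / ellDen p q x N k) *
            ((∏ r, shiftedFac (ellTheta p) q (c * q ^ (∑ r, k r) / (a * x r) / q ^ k r)
              (k r - j r)) /
              (ellDen p q x k j *
                ∏ r, shiftedFac (ellTheta p) q (a * x r * q) (k r + A)))) *
          ((b / c) ^ A * (∏ r, x r ^ j r) * q ^ (-vpairs j)) := by ring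
      _ = _ := by rw [← h1, ← h2]; ring
  rw [sum_congr rfl hterm, ← mul_sum, key, ← hprod, card_stringSet hjN,
    show b * q ^ A / (a * q ^ A) = b / a by field_simp]
  ring

/-- The relation h rewrites every parameter in terms of c; for instance bρ₁/a = cq/ρ₂. The isolated
θ(c) joins (cq)_{|N|+|k|} to form (c)_{|N|+|k|+1}, which gives the summand its very-well-poised
form. -/
theorem betaCoeff_mul_bressoud2 {n : ℕ} {p q : ℂ} (hq : q ≠ 0)
    {x : Fin n → ℂ} (hx : ∀ r, x r ≠ 0) {a b c ρ₁ ρ₂ : ℂ} (ha : a ≠ 0)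
    (hc : c ≠ 0) (hρ₁ : ρ₁ ≠ 0) (hρ₂ : ρ₂ ≠ 0) (h : ρ₁ * ρ₂ * b = c * q * a)
    {N j k : Fin n → ℕ} (hjk : j ≤ k) (hkN : k ≤ N) :
    betaCoeff p q x ρ₁ ρ₂ a b N k * bressoud2 p q x a c k j =
      jacksonTerm p q x ρ₁ ρ₂ a b c N j k := by
  have hbs : b = c * q * a / (ρ₁ * ρ₂) := by field_simp; linear_combination h
  have e1 : b * ρ₁ / a = c * q / ρ₂ := by rw [hbs]; field_simp
  have e2 : b * ρ₂ / a = c * q / ρ₁ := by rw [hbs]; field_simp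
  have e3 : b * ρ₁ * ρ₂ * q ^ (2 * vsum k) / (a * q) = c * q ^ (2 * ∑ r, k r) := by
    have : q ^ (2 * vsum k) = q ^ (2 * ∑ r, k r) := by
      rw [vsum_eq_natCast, ← zpow_natCast]; norm_cast
    rw [this, hbs]
    field_simp
  have e4 : b * ρ₁ * ρ₂ / (a * q) = c := by rw [hbs]; field_simp
  have e5 : b * ρ₁ * ρ₂ / a = c * q := by rw [hbs]; field_simp
  have e6 : a * q / (ρ₁ * ρ₂) = b / c := by rw [hbs]; field_simp
  have e7 : ∀ r, a * x r * q ^ (1 + (k r : ℤ) - vsum k) / (ρ₁ * ρ₂) =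
      b * x r / (c * q ^ ∑ r, k r) * q ^ k r := fun r => by
    rw [vsum_eq_natCast, zpow_sub₀ hq, zpow_one_add₀ hq, zpow_natCast, zpow_natCast, hbs]
    field_simp
  have e8 : ∀ r, c * q ^ (vsum k - (k r : ℤ)) / (a * x r) =
      c * q ^ (∑ r, k r) / (a * x r) / q ^ k r := fun r => by
    have := hx r
    rw [vsum_eq_natCast, zpow_sub₀ hq, zpow_natCast, zpow_natCast]
    field_simp
  have e9 : shiftedFac (ellTheta p) q c (∑ r, N r + ∑ r, k r + 1) =
      ellTheta p c * shiftedFac (ellTheta p) q (c * q) (∑ r, N r + ∑ r, k r) :=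
    shiftedFac_succ' _ _ _ _
  rw [betaCoeff, bressoud2, jacksonTerm, e1, e2, e3, e4, e5, e6, e9]
  simp_rw [e7, e8, ellFac_sub p q _ (hjk _), ellFac_sub p q _ (hkN _), vsum_eq_natCast,
    ← Nat.cast_add, ellFac_natCast, zpow_natCast, prod_mul_distrib]
  ring

theorem mainTheorem8 (n : ℕ) (hn : 0 < n) (p q : ℂ) (hp : ‖p‖ < 1) (hq : q ≠ 0)
    (x : Fin n → ℂ) (hx : ∀ r, x r ≠ 0)
    (a b ρ₁ ρ₂ : ℂ) (ha : a ≠ 0) (hb : b ≠ 0) (hρ₁ : ρ₁ ≠ 0) (hρ₂ : ρ₂ ≠ 0)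
    -- the factors of the denominators do not vanish
    (hqq : ∀ m : ℕ, ellTheta p (q ^ (m + 1)) ≠ 0)
    (hxx : ∀ r s : Fin n, r ≠ s → ∀ m : ℤ, ellTheta p (q ^ m * x r / x s) ≠ 0)
    (hax : ∀ (r : Fin n) (m : ℕ), ellTheta p (a * x r * q ^ (m + 1)) ≠ 0)
    (haρ₁ : ∀ (r : Fin n) (m : ℕ), ellTheta p (a * x r * q ^ (m + 1) / ρ₁) ≠ 0)
    (haρ₂ : ∀ (r : Fin n) (m : ℕ), ellTheta p (a * x r * q ^ (m + 1) / ρ₂) ≠ 0)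
    (hbρ₁ : ∀ m : ℕ, ellTheta p (b * ρ₁ * q ^ m / a) ≠ 0)
    (hbρ₂ : ∀ m : ℕ, ellTheta p (b * ρ₂ * q ^ m / a) ≠ 0)
    (hbρ : ∀ m : ℕ, ellTheta p (b * ρ₁ * ρ₂ * q ^ m / (a * q)) ≠ 0)
    (α β : ℂ → ℂ → (Fin n → ℕ) → ℂ)
    (hαβ : IsWPBaileyPair (bressoud2 p q x) α β a (b * ρ₁ * ρ₂ / (a * q))) :
    IsWPBaileyPair (bressoud1 p q x)
      (alphaPrime p q x ρ₁ ρ₂ α) (betaPrime p q x ρ₁ ρ₂ β) a b := by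
  intro N
  set c := b * ρ₁ * ρ₂ / (a * q) with hcdef
  have hc : c ≠ 0 := by positivity
  have h : ρ₁ * ρ₂ * b = c * q * a := by rw [hcdef]; field_simp
  have e1 : b * ρ₁ / a = c * q / ρ₂ := by rw [hcdef]; field_simp
  have e2 : b * ρ₂ / a = c * q / ρ₁ := by rw [hcdef]; field_simp
  have e6 : a * q / (ρ₁ * ρ₂) = b / c := by rw [hcdef]; field_simp
  have hnz : ∀ m : ℕ, ellTheta p (c * q ^ m) ≠ 0 := fun m => by
    rw [hcdef, div_mul_eq_mul_div]; exact hbρ m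
  have hnz₁ : ∀ m : ℕ, ellTheta p (c * q / ρ₁ * q ^ m) ≠ 0 := fun m => by
    rw [← e2, div_mul_eq_mul_div]; exact hbρ₂ m
  have hnz₂ : ∀ m : ℕ, ellTheta p (c * q / ρ₂ * q ^ m) ≠ 0 := fun m => by
    rw [← e1, div_mul_eq_mul_div]; exact hbρ₁ m
  have hax' : ∀ (r : Fin n) (m : ℕ), ellTheta p (a * x r * q * q ^ m) ≠ 0 := fun r m => by
    rw [mul_assoc _ q, ← pow_succ']; exact hax r m
  have hr₁ : ∀ (r : Fin n) (m : ℕ), ellTheta p (a * x r * q / ρ₁ * q ^ m) ≠ 0 := fun r m => by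
    rw [div_mul_eq_mul_div, mul_assoc _ q, ← pow_succ']; exact haρ₁ r m
  have hr₂ : ∀ (r : Fin n) (m : ℕ), ellTheta p (a * x r * q / ρ₂ * q ^ m) ≠ 0 := fun r m => by
    rw [div_mul_eq_mul_div, mul_assoc _ q, ← pow_succ']; exact haρ₂ r m
  have hb' : betaPrime p q x ρ₁ ρ₂ β a b N =
      ellFac p q (b * ρ₁ / a) (vsum N) * ellFac p q (b * ρ₂ / a) (vsum N) /
        (∏ r, ellFac p q (a * x r * q / ρ₁) (N r) * ellFac p q (a * x r * q / ρ₂) (N r)) *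
      ∑ k ∈ Icc 0 N, betaCoeff p q x ρ₁ ρ₂ a b N k * β a c k := rfl
  have hswap : ∑ k ∈ Icc 0 N, betaCoeff p q x ρ₁ ρ₂ a b N k * β a c k =
      ∑ j ∈ Icc 0 N, (∑ k ∈ Icc j N, jacksonTerm p q x ρ₁ ρ₂ a b c N j k) * α a c j := by
    have h1 : ∀ k ∈ Icc 0 N, betaCoeff p q x ρ₁ ρ₂ a b N k * β a c k =
        ∑ j ∈ Icc 0 k, jacksonTerm p q x ρ₁ ρ₂ a b c N j k * α a c j := fun k hk => by
      rw [hαβ k, mul_sum]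
      refine sum_congr rfl fun j hj => ?_
      rw [← mul_assoc, betaCoeff_mul_bressoud2 hq hx ha hc hρ₁ hρ₂ h (mem_Icc.mp hj).2
        (mem_Icc.mp hk).2]
    -- Summation over the chains 0 ≤ j ≤ k ≤ N in the other order; the inner sum over k is now a
    -- Jackson sum, and α j is constant in it.
    rw [sum_congr rfl h1, sum_comm' (t' := Icc 0 N) (s' := fun j => Icc j N)]
    · simp_rw [sum_mul]
    · intro k j
      simp only [mem_Icc]
      constructor
      · rintro ⟨⟨_, h2⟩, h3, h4⟩
        exact ⟨⟨h4, h2⟩, h3, h4.trans h2⟩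
      · rintro ⟨⟨h1, h2⟩, h3, _⟩
        exact ⟨⟨h3.trans h1, h2⟩, h3, h1⟩
  rw [hb', hswap, mul_sum]
  refine sum_congr rfl fun j hj => ?_
  have hjN := (mem_Icc.mp hj).2
  have hAL : ∑ r, j r ≤ ∑ r, N r := sum_le_sum fun r _ => hjN r
  have key := sum_jacksonTerm hp hq hx ha hb hc hρ₁ hρ₂ h hqq hxx hax' hnz hnz₁ hnz₂ hjN
  have hα : alphaPrime p q x ρ₁ ρ₂ α a b j =
      ellFac p q ρ₁ (vsum j) * ellFac p q ρ₂ (vsum j) /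
        (∏ r, ellFac p q (a * x r * q / ρ₁) (j r) * ellFac p q (a * x r * q / ρ₂) (j r)) *
      (a * q / (ρ₁ * ρ₂)) ^ vsum j * (∏ r, x r ^ j r) * q ^ (-vpairs j) * α a c j := rfl
  have hB : bressoud1 p q x a b N j =
      shiftedFac (ellTheta p) q (b / a) (∑ r, N r - ∑ r, j r) / ellDen p q x N j *
        ((∏ r, shiftedFac (ellTheta p) q (b * x r) (∑ r, N r + j r)) /
          ∏ r, shiftedFac (ellTheta p) q (a * x r * q) (N r + ∑ r, j r)) := by
    rw [bressoud1, vsum_eq_natCast, vsum_eq_natCast, ellFac_sub p q _ hAL, prod_div_distrib]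
    simp_rw [← Nat.cast_add, ellFac_natCast, add_comm (j _)]
  rw [hα, hB, e1, e2, e6]
  simp_rw [vsum_eq_natCast, ellFac_natCast, zpow_natCast]
  have n1 : ∏ r, shiftedFac (ellTheta p) q (a * x r * q / ρ₁) (j r) *
      shiftedFac (ellTheta p) q (a * x r * q / ρ₂) (j r) ≠ 0 :=
    prod_ne_zero_iff.mpr fun r _ =>
      mul_ne_zero (shiftedFac_ne_zero (hr₁ r) _) (shiftedFac_ne_zero (hr₂ r) _)
  have n2 : ∏ r, shiftedFac (ellTheta p) q (a * x r * q / ρ₁) (N r) *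
      shiftedFac (ellTheta p) q (a * x r * q / ρ₂) (N r) ≠ 0 :=
    prod_ne_zero_iff.mpr fun r _ =>
      mul_ne_zero (shiftedFac_ne_zero (hr₁ r) _) (shiftedFac_ne_zero (hr₂ r) _)
  have n3 := shiftedFac_ne_zero hnz₁ (∑ r, N r)
  have n4 := shiftedFac_ne_zero hnz₂ (∑ r, N r)
  have n5 := ellDen_ne_zero hp hq hx hqq hxx hjN
  have n6 : ∏ r, shiftedFac (ellTheta p) q (a * x r * q) (N r + ∑ r, j r) ≠ 0 :=
    prod_ne_zero_iff.mpr fun r _ => shiftedFac_ne_zero (hax' r) _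
  -- The Jackson summation, solved for the inner sum. Its product over N cancels the prefactor of
  -- β'_N, and the products over j that it is divided by are the denominator of α'_j.
  rw [eq_div_of_mul_eq n1 ((mul_comm _ _).trans key)]
  clear key
  generalize ∏ r, shiftedFac (ellTheta p) q (a * x r * q / ρ₁) (j r) *
      shiftedFac (ellTheta p) q (a * x r * q / ρ₂) (j r) = t₁ at *
  generalize ∏ r, shiftedFac (ellTheta p) q (a * x r * q / ρ₁) (N r) *
      shiftedFac (ellTheta p) q (a * x r * q / ρ₂) (N r) = t₂ at *
  generalize shiftedFac (ellTheta p) q (c * q / ρ₁) (∑ r, N r) = t₃ at *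
  generalize shiftedFac (ellTheta p) q (c * q / ρ₂) (∑ r, N r) = t₄ at *
  generalize ellDen p q x N j = t₅ at *
  generalize ∏ r, shiftedFac (ellTheta p) q (a * x r * q) (N r + ∑ r, j r) = t₆ at *
  generalize ∏ r, shiftedFac (ellTheta p) q (b * x r) (∑ r, N r + j r) = t₇
  generalize shiftedFac (ellTheta p) q (b / a) (∑ r, N r - ∑ r, j r) = t₈
  generalize (b / c) ^ ∑ r, j r = t₉
  generalize q ^ (-vpairs j) = t₁₀
  generalize ∏ r, x r ^ j r = t₁₁
  clear * - n1 n2 n3 n4 n5 n6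
  field_simp
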